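/- Let $p$ be transition probabilities on $\mathbb Z$ with $p(x,y)=p(y,x)=p(0,y-x)$ and $p(0,0)=0$, and let $K\ge 1$ be an integer. The $K$-particle-per-site symmetric exclusion process ($K$-SEP) is the càdlàg Markov process $(\eta_t)_{t\ge0}$ on $\{0,1,\dots,K\}^{\mathbb Z}$ with generator (the process being characterized as the solution of the martingale problem for this generator on functions $f$ of finitely many sites) $$\mathcal L_Kf(\eta)=\sum_{x,y\in\mathbb Z}p(x,y)\,\eta(x)\,(K-\eta(y))\,\bigl(f(\eta^{x,y})-f(\eta)\bigr),$$ where $\eta^{x,y}$ is obtained from $\eta$ by moving one particle from $x$ to $y$. Write $\mathbb E_\eta$ for the expectation when $\eta_0=\eta$. Let $N_t=\sum_{x\in\mathbb Z}\eta_t(x)\,\delta_x$ be the point process of particle positions and $\mu_t^\eta(\cdot)=\mathbb E_\eta[N_t(\cdot)]$ its mean measure. For a counting measure $\sum_{i\in S}\delta_{x_i}$ and an integer $n\ge0$, its $n$-th factorial measure is the sum of $\delta_{(x_{i_1},\dots,x_{i_n})}$ over the $n$-tuples of pairwise distinct indices in $S$; $N_t^{(n)}$ is the $n$-th factorial measure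 of $N_t$ (each particle being one index). Let $\zeta_t$ be the continuous time random walk on $\mathbb Z$ with jumps at rate $1$ and transition probabilities $p$, started from $x$ under $P_x$, and for Borel sets $A,B\subset\mathbb R$ put $$\tau_t(A,B)=\sum_{x\in A\cap\mathbb Z}P_x(\zeta_t\in B)^2,$$ $$\kappa_t(A,B)=\sum_{x,y\in\mathbb Z}p(x,y)\int_0^t\bigl(P_x(\zeta_s\in B)-P_y(\zeta_s\in B)\bigr)^2P_x(\zeta_{t-s}\in A)\,P_y(\zeta_{t-s}\in A)\,ds.$$ Let $m\ge1$, let $A_k=(a_k,b_k]$, $1\le k\le m$, be bounded, pairwise disjoint intervals, and let $A=(\min_k a_k,\max_k b_k]$. Then for every $\eta\in\{0,K\}^{\mathbb Z}$, all integers $n_1,\dots,n_m\ge 0$ and all $t\ge0$, with $M=n_1+\dots+n_m$, the expectations below are finite and $$0\le\prod_{k=1}^m\bigl(\mu^\eta_{t/K}(A_k)\bigr)^{n_k}-\mathbb E_\eta\Bigl[\prod_{k=1}^mN_{t/K}^{(n_k)}(A_k^{n_k})\Bigr]\le K^2\binom{M}{2}\bigl(\mu^\eta_{t/K}(A)\bigr)^{M-2}\bigl(\kappa_t(A,\{\eta>0\})+\tau_t(A,\{\eta>0\})\bigr),$$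 where the right-hand side is read as $0$ when $M\le1$. -/

import Mathlib

open MeasureTheory Filter Topology Set
open scoped NNReal ENNReal

noncomputable section

/-- Symmetric, translation invariant random walk transition probabilities on `ℤ` that
charge no self-jumps. -/
structure IsJumpKernel (p : ℤ → ℤ → ℝ) : Prop where
  nonneg : ∀ x y, 0 ≤ p x y
  hasSum_one : ∀ x, HasSum (p x) 1
  symm : ∀ x y, p x y = p y x
  translation : ∀ x y, p x y = p 0 (y - x)
  zero_diag : p 0 0 = 0

/-! ### The single random walk -/

/-- The `n`-step transition probabilities of the discrete time walk with kernel `p`. -/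
def stepProb (p : ℤ → ℤ → ℝ) : ℕ → ℤ → ℤ → ℝ
  | 0, x, y => if x = y then 1 else 0
  | n + 1, x, y => ∑' z : ℤ, p x z * stepProb p n z y

open Classical in
/-- `P_x(ζ_t ∈ B)` for the continuous time random walk `ζ` on `ℤ` started from `x`, with jumps
at rate `1` and transition probabilities `p`: the number of jumps up to time `t` is Poisson with
mean `t`, independent of the discrete skeleton. -/
def walkProb (p : ℤ → ℤ → ℝ) (t : ℝ) (x : ℤ) (B : Set ℝ) : ℝ :=
  ∑' n : ℕ, Real.exp (-t) * t ^ n / (n.factorial : ℝ) *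
    ∑' y : ℤ, if (y : ℝ) ∈ B then stepProb p n x y else 0

open Classical in
/-- `τ_t(A, B) = ∑_{x ∈ A ∩ ℤ} P_x(ζ_t ∈ B)²`, with values in `[0, ∞]`. -/
def tau (p : ℤ → ℤ → ℝ) (t : ℝ) (A B : Set ℝ) : ℝ≥0∞ :=
  ∑' x : ℤ, if (x : ℝ) ∈ A then ENNReal.ofReal (walkProb p t x B ^ 2) else 0

/-- `κ_t(A, B) = ∑_{x,y} p(x,y) ∫_0^t (P_x(ζ_s ∈ B) - P_y(ζ_s ∈ B))²
P_x(ζ_{t-s} ∈ A) P_y(ζ_{t-s} ∈ A) ds`, with values in `[0, ∞]`. -/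
def kappa (p : ℤ → ℤ → ℝ) (t : ℝ) (A B : Set ℝ) : ℝ≥0∞ :=
  ∑' (x : ℤ) (y : ℤ), ENNReal.ofReal (p x y) *
    ∫⁻ s in Icc 0 t, ENNReal.ofReal
      ((walkProb p s x B - walkProb p s y B) ^ 2 *
        walkProb p (t - s) x A * walkProb p (t - s) y A)

/-! ### The `K`-particle-per-site symmetric exclusion process -/

/-- The configuration `η^{x,y}`, in which one particle has moved from `x` to `y`. -/
def moveParticle (η : ℤ → ℕ) (x y : ℤ) : ℤ → ℕ :=
  fun u => if u = x then η x - 1 else if u = y then η y + 1 else η u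

/-- The generator of `K`-SEP, for configurations `η` with at most `K` particles per site and
functions `f` depending on finitely many sites (the sum is then absolutely convergent):
`L f (η) = ∑_{x,y} p(x,y) η(x) (K - η(y)) (f(η^{x,y}) - f(η))`. -/
def ksepGenerator (p : ℤ → ℤ → ℝ) (K : ℕ) (f : (ℤ → ℕ) → ℝ) (η : ℤ → ℕ) : ℝ :=
  ∑' q : ℤ × ℤ, p q.1 q.2 * (η q.1 : ℝ) * ((K : ℝ) - (η q.2 : ℝ)) *
    (f (moveParticle η q.1 q.2) - f η)

/-- `X` is a `K`-SEP with jump kernel `p` and deterministic initial profile `η₀` on the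
probability space `(Ω, P)`: a càdlàg process with values in the configurations with at most `K`
particles per site (with the product topology) that starts from `η₀` and solves the martingale
problem for the generator `ksepGenerator p K` on the functions of finitely many sites. -/
structure IsKSEP (p : ℤ → ℤ → ℝ) (K : ℕ) {Ω : Type*} [mΩ : MeasurableSpace Ω] (P : Measure Ω)
    (η₀ : ℤ → ℕ) (X : ℝ≥0 → Ω → ℤ → ℕ) : Prop where
  le_K : ∀ t ω x, X t ω x ≤ K
  right_cont : ∀ ω t, ContinuousWithinAt (fun s => X s ω) (Ici t) t
  left_lim : ∀ ω t, ∃ l : ℤ → ℕ, Tendsto (fun s => X s ω) (𝓝[<] t) (𝓝 l)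
  initial : ∀ᵐ ω ∂P, X 0 ω = η₀
  martingale_problem : ∃ ℱ : Filtration ℝ≥0 mΩ,
    (∀ t, Measurable[ℱ t] (X t)) ∧
    ∀ (S : Finset ℤ) (f : (ℤ → ℕ) → ℝ), DependsOn f (S : Set ℤ) →
      Martingale (fun t ω => f (X t ω) - f (X 0 ω) -
        ∫ s in (0 : ℝ)..t, ksepGenerator p K f (X s.toNNReal ω)) ℱ P

/-! ### The point process of particles and its factorial measures -/

/-- The counting measure `∑_i δ_{x_i}` of a family of (not necessarily distinct) points. -/
def countingMeasure {S : Type*} (x : S → ℝ) : Measure ℝ :=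
  Measure.sum fun i : S => Measure.dirac (x i)

/-- The `n`-th order factorial measure `∑ δ_{(x_{i_1}, …, x_{i_n})}` of `∑_i δ_{x_i}`, the sum
being over the `n`-tuples of pairwise distinct indices. -/
def factorialMeasure {S : Type*} (x : S → ℝ) (n : ℕ) : Measure (Fin n → ℝ) :=
  Measure.sum fun i : Fin n ↪ S => Measure.dirac fun r => x (i r)

/-- The particles of a configuration: `η x` of them at the site `x`. -/
def Particle (η : ℤ → ℕ) : Type := {q : ℤ × ℕ // q.2 < η q.1}

/-- The position of a particle. -/
def Particle.pos {η : ℤ → ℕ} (q : Particle η) : ℝ := (q.1.1 : ℝ)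

/-- The point process `N` of the particle positions of a configuration, so that
`N(A) = ∑_{x ∈ A ∩ ℤ} η(x)`. -/
def particleMeasure (η : ℤ → ℕ) : Measure ℝ :=
  countingMeasure (Particle.pos (η := η))

/-- The factorial measure `N^{(n)}` of the point process of particle positions. -/
def particleFactorialMeasure (η : ℤ → ℕ) (n : ℕ) : Measure (Fin n → ℝ) :=
  factorialMeasure (Particle.pos (η := η)) n

/-- The mean measure `A ↦ E[N(A)]` of the particles of a random configuration `Y`. -/
def meanMeasure {Ω : Type*} [MeasurableSpace Ω] (P : Measure Ω) (Y : Ω → ℤ → ℕ) (A : Set ℝ) :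
    ℝ≥0∞ :=
  ∫⁻ ω, particleMeasure (Y ω) A ∂P

/-- The joint factorial moment `E[∏_k N^{(n_k)}(A_k^{n_k})]` of the particles of a random
configuration `Y`. -/
def jointFactorialMoment {Ω : Type*} [MeasurableSpace Ω] (P : Measure Ω) (Y : Ω → ℤ → ℕ)
    {m : ℕ} (n : Fin m → ℕ) (A : Fin m → Set ℝ) : ℝ≥0∞ :=
  ∫⁻ ω, ∏ k, particleFactorialMeasure (Y ω) (n k) (Set.univ.pi fun _ => A k) ∂P

/-- The set `{η > 0}` of occupied sites, as a set of reals. -/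
def occupied (η : ℤ → ℕ) : Set ℝ := (fun x : ℤ => (x : ℝ)) '' {x : ℤ | 0 < η x}

end

/-! The proof compares the product of means and the factorial moment as sums over `M`-tuples of
sites, one coordinate for each particle counted. By a Vandermonde identity (`sum_facProd`) the
product of factorial counts is the sum of `facProd` over the tuples with coordinates in the
prescribed intervals. Divided by its value `exclWeight` for the full configuration, `facProd` is a
self-duality function of the process (`ksepGenerator_dual`). The martingale problem then gives a
closed linear equation, with a bounded operator, for the means of these functions, whose unique
solution is the semigroup `exclSemi` of `M` particles in exclusion interaction
(`IsKSEP.dualMean_eq`). For `η` with values in `{0, K}` the initial datum is the product of the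
indicators of `{η > 0}`, restricted to admissible tuples.

With `h = walkFun hp B t`, `B = {η > 0}`, `w = exclWeight` and `u` the dual expectation, the
difference is the sum over tuples of `K ^ M ∏ h - w u`, that is of `(K ^ M - w) ∏ h + w (admInd ∏ h
- u)`. The first summand vanishes unless two coordinates coincide, and a union bound over pairs
produces `τ` (`pow_sub_exclWeight_le`, `sum_coincidence_le`).

For the second summand, Duhamel's formula writes `admInd ∏ h - u` as a time integral of `exclSemi`
applied to `source`. Only jumps onto a site of another coordinate are affected by exclusion, so
`source` is a sum over pairs, and symmetry of `p` turns each pair into a square (`source_apply`).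
Hence it is nonnegative, which gives negative correlation (`exclSemi_le`) and the lower bound. For
the upper bound, reversibility with respect to `w` moves the semigroup from `source` to the
indicator of `A`, where `exclSemi_le` replaces it by independent walks. The sum then factorises: the
pair gives `κ`, and each remaining coordinate gives a mean by Chapman-Kolmogorov
(`sum_interaction_le`). -/

/-! ### Exponentials of bounded operators: positivity, reversibility, Duhamel's formula -/

section Semigroup

open scoped BoundedContinuousFunction

section Flow

variable {V : Type*} [NormedAddCommGroup V] [NormedSpace ℝ V]

/-- The flow `exp (t G)` of a bounded operator. -/
noncomputable def flow (G : V →L[ℝ] V) (t : ℝ) : V →L[ℝ] V := NormedSpace.exp (t • G)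

theorem flow_zero (G : V →L[ℝ] V) : flow G 0 = 1 := by
  rw [flow, zero_smul, NormedSpace.exp_zero]

variable [CompleteSpace V]

theorem flow_add (G : V →L[ℝ] V) (s t : ℝ) : flow G (s + t) = flow G s * flow G t := by
  let _ : NormedAlgebra ℚ (V →L[ℝ] V) := NormedAlgebra.restrictScalars ℚ ℝ _
  rw [flow, add_smul, NormedSpace.exp_add_of_commute, flow, flow]
  exact (Commute.refl _).smul_left _ |>.smul_right _

/-- The identity commutes with `G`. This reduces positivity and symmetry of the semigroup of `Q - c`
to those of the power series of `Q`. -/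
theorem flow_sub_smul_one (G : V →L[ℝ] V) (c t : ℝ) :
    flow (G - c • 1) t = Real.exp (-(c * t)) • flow G t := by
  let _ : NormedAlgebra ℚ (V →L[ℝ] V) := NormedAlgebra.restrictScalars ℚ ℝ _
  have h1 : t • (G - c • (1 : V →L[ℝ] V)) = algebraMap ℝ _ (-(c * t)) + t • G := by
    rw [Algebra.algebraMap_eq_smul_one, smul_sub, smul_smul, neg_smul, mul_comm c t]
    abel
  rw [flow, flow, h1, NormedSpace.exp_add_of_commute (Algebra.commutes _ _),
    ← NormedSpace.algebraMap_exp_comm, Algebra.algebraMap_eq_smul_one, smul_mul_assoc, one_mul,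
    Real.exp_eq_exp_ℝ]

theorem hasDerivAt_flow (G : V →L[ℝ] V) (t : ℝ) :
    HasDerivAt (flow G) (flow G t * G) t :=
  hasDerivAt_exp_smul_const G t

theorem hasDerivAt_flow_apply (G : V →L[ℝ] V) (t : ℝ) (f : V) :
    HasDerivAt (fun s => flow G s f) (G (flow G t f)) t := by
  have h : HasDerivAt (flow G) (G * flow G t) t := hasDerivAt_exp_smul_const' G t
  have h2 := h.clm_apply (hasDerivAt_const t f)
  simpa using h2

theorem continuous_flow (G : V →L[ℝ] V) : Continuous (flow G) :=
  continuous_iff_continuousAt.2 fun s => (hasDerivAt_flow G s).continuousAt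

theorem hasSum_flow_apply (G : V →L[ℝ] V) (t : ℝ) (f : V) :
    HasSum (fun n : ℕ => (t ^ n / (n.factorial : ℝ)) • (G ^ n) f) (flow G t f) := by
  have h := NormedSpace.exp_series_hasSum_exp' (𝕂 := ℝ) (t • G)
  have h2 := h.mapL (ContinuousLinearMap.apply ℝ V f)
  convert h2 using 2 with n
  · rw [smul_pow, smul_smul, ContinuousLinearMap.apply_apply, div_eq_inv_mul]
    rfl
  · rfl

/-- In the derivative of `flow G (T - s) (y s)` the two terms with `G` cancel and only the forcing
`g` remains; integrate from `0` to `T`. -/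
theorem duhamel (G : V →L[ℝ] V) {T : ℝ} (hT : 0 ≤ T) {y g : ℝ → V}
    (hy : ContinuousOn y (Icc 0 T))
    (hy' : ∀ s ∈ Ioo 0 T, HasDerivAt y (G (y s) + g s) s) (hg : ContinuousOn g (Icc 0 T)) :
    y T = flow G T (y 0) + ∫ s in (0 : ℝ)..T, flow G (T - s) (g s) := by
  have hc : Continuous fun s : ℝ => flow G (T - s) :=
    (continuous_flow G).comp (continuous_const.sub continuous_id)
  have hd : ∀ s : ℝ, HasDerivAt (fun s : ℝ => flow G (T - s)) (-(flow G (T - s) * G)) s := by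
    intro s
    have h1 := (hasDerivAt_flow G (T - s)).scomp s ((hasDerivAt_id s).const_sub T)
    rw [neg_one_smul] at h1
    exact h1
  have hint : IntervalIntegrable (fun s => flow G (T - s) (g s)) volume 0 T := by
    apply ContinuousOn.intervalIntegrable
    rw [uIcc_of_le hT]
    exact hc.continuousOn.clm_apply hg
  have key := intervalIntegral.integral_eq_sub_of_hasDerivAt_of_le
    (f := fun s => flow G (T - s) (y s)) (f' := fun s => flow G (T - s) (g s)) hT
    (hc.continuousOn.clm_apply hy) (fun s hs => by
      have := (hd s).clm_apply (hy' s hs)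
      convert this using 1
      simp) hint
  rw [key]
  simp [flow_zero]

end Flow

variable {E : Type*} [TopologicalSpace E]

/-- A bounded operator that maps nonnegative functions to nonnegative functions. -/
def IsPosOp (Q : (E →ᵇ ℝ) →L[ℝ] (E →ᵇ ℝ)) : Prop :=
  ∀ f : E →ᵇ ℝ, (∀ x, 0 ≤ f x) → ∀ x, 0 ≤ Q f x

/-- A bounded operator that is symmetric with respect to the weight `w`. -/
def IsWeightSymm (w : E → ℝ≥0∞) (Q : (E →ᵇ ℝ) →L[ℝ] (E →ᵇ ℝ)) : Prop :=
  ∀ f g : E →ᵇ ℝ, (∀ x, 0 ≤ f x) → (∀ x, 0 ≤ g x) →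
    ∑' x, w x * (ENNReal.ofReal (f x) * ENNReal.ofReal (Q g x)) =
      ∑' x, w x * (ENNReal.ofReal (Q f x) * ENNReal.ofReal (g x))

/-- The semigroup `exp (t (Q - c))`. -/
noncomputable def semi (Q : (E →ᵇ ℝ) →L[ℝ] (E →ᵇ ℝ)) (c t : ℝ) : (E →ᵇ ℝ) →L[ℝ] (E →ᵇ ℝ) :=
  flow (Q - c • 1) t

variable {Q : (E →ᵇ ℝ) →L[ℝ] (E →ᵇ ℝ)}

theorem semi_eq (Q : (E →ᵇ ℝ) →L[ℝ] (E →ᵇ ℝ)) (c t : ℝ) :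
    semi Q c t = Real.exp (-(c * t)) • flow Q t := flow_sub_smul_one Q c t

theorem continuous_semi (Q : (E →ᵇ ℝ) →L[ℝ] (E →ᵇ ℝ)) (c : ℝ) (f : E →ᵇ ℝ) :
    Continuous fun s => semi Q c s f :=
  (continuous_flow (Q - c • 1)).clm_apply continuous_const

theorem hasSum_flow_eval (Q : (E →ᵇ ℝ) →L[ℝ] (E →ᵇ ℝ)) (t : ℝ) (f : E →ᵇ ℝ) (x : E) :
    HasSum (fun n : ℕ => t ^ n / (n.factorial : ℝ) * (Q ^ n) f x) (flow Q t f x) :=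
  (hasSum_flow_apply Q t f).mapL (BoundedContinuousFunction.evalCLM ℝ x)

theorem IsPosOp.pow (hQ : IsPosOp Q) (n : ℕ) : IsPosOp (Q ^ n) := by
  induction n with
  | zero => intro f hf x; simpa using hf x
  | succ n ih =>
    intro f hf x
    rw [pow_succ']
    exact hQ _ (ih f hf) x

/-- All coefficients of the exponential series are nonnegative, as are all powers of `Q`. -/
theorem IsPosOp.flow_op (hQ : IsPosOp Q) {t : ℝ} (ht : 0 ≤ t) :
    IsPosOp (flow Q t) := fun f hf x =>
  (hasSum_flow_eval Q t f x).nonneg fun n => mul_nonneg (by positivity) (hQ.pow n f hf x)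

theorem IsPosOp.semi_op (hQ : IsPosOp Q) (c : ℝ) {t : ℝ} (ht : 0 ≤ t) : IsPosOp (semi Q c t) := by
  intro f hf x
  rw [semi_eq]
  exact mul_nonneg (Real.exp_pos _).le (hQ.flow_op ht f hf x)

theorem IsPosOp.sum {ι : Type*} (s : Finset ι) {R : ι → (E →ᵇ ℝ) →L[ℝ] (E →ᵇ ℝ)}
    (hR : ∀ i ∈ s, IsPosOp (R i)) : IsPosOp (∑ i ∈ s, R i) := by
  intro f hf x
  simp only [_root_.sum_apply, BoundedContinuousFunction.sum_apply]
  exact Finset.sum_nonneg fun i hi => hR i hi f hf x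

variable {w : E → ℝ≥0∞}

theorem IsWeightSymm.pow (hP : IsPosOp Q) (hQ : IsWeightSymm w Q) (n : ℕ) : IsWeightSymm w (Q ^ n) := by
  induction n with
  | zero => intro f g hf hg; simp
  | succ n ih =>
    intro f g hf hg
    have h1 : (Q ^ (n + 1)) g = Q ((Q ^ n) g) := by rw [pow_succ']; rfl
    have h2 : (Q ^ (n + 1)) f = (Q ^ n) (Q f) := by rw [pow_succ]; rfl
    rw [h1, h2, hQ f _ hf (hP.pow n g hg), ih _ g (hP f hf) hg]

/-- Symmetry passes to powers and then to the series term by term. Working in `ℝ≥0∞` makes every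
interchange of sums free, even when the sum over `E` diverges. -/
theorem IsWeightSymm.flow_op (hP : IsPosOp Q) (hQ : IsWeightSymm w Q) {t : ℝ} (ht : 0 ≤ t) :
    IsWeightSymm w (flow Q t) := by
  intro f g hf hg
  have key : ∀ g : E →ᵇ ℝ, (∀ x, 0 ≤ g x) → ∀ x,
      ENNReal.ofReal (flow Q t g x) =
      ∑' n : ℕ, ENNReal.ofReal (t ^ n / (n.factorial : ℝ)) * ENNReal.ofReal ((Q ^ n) g x) := by
    intro g hg x
    have h := hasSum_flow_eval Q t g x
    rw [← h.tsum_eq, ENNReal.ofReal_tsum_of_nonneg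
      (fun n => mul_nonneg (by positivity) (hP.pow n g hg x)) h.summable]
    exact tsum_congr fun n => ENNReal.ofReal_mul (by positivity)
  simp_rw [key g hg, key f hf, ← ENNReal.tsum_mul_left, ← ENNReal.tsum_mul_right,
    ← ENNReal.tsum_mul_left]
  rw [ENNReal.tsum_comm, ENNReal.tsum_comm (α := E)]
  refine tsum_congr fun n => ?_
  have h := hQ.pow hP n f g hf hg
  calc _ = ENNReal.ofReal (t ^ n / (n.factorial : ℝ)) *
        ∑' x, w x * (ENNReal.ofReal (f x) * ENNReal.ofReal ((Q ^ n) g x)) := by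
        rw [← ENNReal.tsum_mul_left]; exact tsum_congr fun x => by ring
    _ = _ := by
        rw [h, ← ENNReal.tsum_mul_left]; exact tsum_congr fun x => by ring

theorem IsWeightSymm.semi_op (hP : IsPosOp Q) (hQ : IsWeightSymm w Q) (c : ℝ) {t : ℝ} (ht : 0 ≤ t) :
    IsWeightSymm w (semi Q c t) := by
  intro f g hf hg
  have h := hQ.flow_op hP ht f g hf hg
  have key : ∀ (g : E →ᵇ ℝ) x, ENNReal.ofReal (semi Q c t g x) =
      ENNReal.ofReal (Real.exp (-(c * t))) *
        ENNReal.ofReal (flow Q t g x) := by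
    intro g x
    rw [semi_eq, ← ENNReal.ofReal_mul (Real.exp_pos _).le]
    rfl
  simp_rw [key]
  calc _ = ENNReal.ofReal (Real.exp (-(c * t))) *
        ∑' x, w x * (ENNReal.ofReal (f x) * ENNReal.ofReal (flow Q t g x)) := by
        rw [← ENNReal.tsum_mul_left]; exact tsum_congr fun x => by ring
    _ = _ := by
        rw [h, ← ENNReal.tsum_mul_left]; exact tsum_congr fun x => by ring

theorem IsWeightSymm.sum {ι : Type*} (s : Finset ι) {R : ι → (E →ᵇ ℝ) →L[ℝ] (E →ᵇ ℝ)}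
    (hP : ∀ i ∈ s, IsPosOp (R i)) (hR : ∀ i ∈ s, IsWeightSymm w (R i)) :
    IsWeightSymm w (∑ i ∈ s, R i) := by
  intro f g hf hg
  have key : ∀ g : E →ᵇ ℝ, (∀ x, 0 ≤ g x) → ∀ x, ENNReal.ofReal ((∑ i ∈ s, R i) g x) =
      ∑ i ∈ s, ENNReal.ofReal (R i g x) := by
    intro g hg x
    simp only [_root_.sum_apply, BoundedContinuousFunction.sum_apply]
    exact ENNReal.ofReal_sum_of_nonneg fun i hi => hP i hi g hg x
  simp_rw [key f hf, key g hg, Finset.sum_mul, Finset.mul_sum]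
  rw [Summable.tsum_finsetSum fun _ _ => ENNReal.summable,
    Summable.tsum_finsetSum fun _ _ => ENNReal.summable]
  exact Finset.sum_congr rfl fun i hi => hR i hi f g hf hg

/-- Data of a jump mechanism: in state `x` the move `u` is proposed with weight `r x u`, and
it is then accepted with probability `a x u`, leading to the state `T x u`. -/
structure JumpData (E W : Type*) where
  /-- proposal probabilities -/
  r : E → W → ℝ
  /-- acceptance probabilities -/
  a : E → W → ℝ
  /-- the state after the move -/
  T : E → W → E
  r_nonneg : ∀ x u, 0 ≤ r x u
  r_sum : ∀ x, HasSum (r x) 1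
  a_nonneg : ∀ x u, 0 ≤ a x u
  a_le_one : ∀ x u, a x u ≤ 1

namespace JumpData

variable {W : Type*} (D : JumpData E W)

omit [TopologicalSpace E] in
theorem summable_mul (x : E) {φ : W → ℝ} {C : ℝ} (hφ : ∀ u, |φ u| ≤ C) :
    Summable fun u => D.r x u * φ u := by
  refine Summable.of_norm_bounded ((D.r_sum x).summable.mul_right C) fun u => ?_
  rw [Real.norm_eq_abs, abs_mul, abs_of_nonneg (D.r_nonneg x u)]
  exact mul_le_mul_of_nonneg_left (hφ u) (D.r_nonneg x u)

theorem abs_mix_le (f : E →ᵇ ℝ) (x : E) (u : W) :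
    |(1 - D.a x u) * f x + D.a x u * f (D.T x u)| ≤ ‖f‖ := by
  have h1 := f.norm_coe_le_norm x
  have h2 := f.norm_coe_le_norm (D.T x u)
  rw [Real.norm_eq_abs] at h1 h2
  have ha := D.a_nonneg x u
  have ha' : 0 ≤ 1 - D.a x u := sub_nonneg.2 (D.a_le_one x u)
  calc _ ≤ |(1 - D.a x u) * f x| + |D.a x u * f (D.T x u)| := abs_add_le _ _
    _ = (1 - D.a x u) * |f x| + D.a x u * |f (D.T x u)| := by
      rw [abs_mul, abs_mul, abs_of_nonneg ha, abs_of_nonneg ha']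
    _ ≤ (1 - D.a x u) * ‖f‖ + D.a x u * ‖f‖ := by gcongr
    _ = ‖f‖ := by ring

theorem summable_mix (f : E →ᵇ ℝ) (x : E) :
    Summable fun u => D.r x u * ((1 - D.a x u) * f x + D.a x u * f (D.T x u)) :=
  D.summable_mul x (D.abs_mix_le f x)

theorem abs_tsum_mix_le (f : E →ᵇ ℝ) (x : E) :
    |∑' u, D.r x u * ((1 - D.a x u) * f x + D.a x u * f (D.T x u))| ≤ ‖f‖ := by
  have h : HasSum (fun u => D.r x u * ‖f‖) (1 * ‖f‖) := (D.r_sum x).mul_right _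
  rw [one_mul] at h
  rw [← Real.norm_eq_abs]
  refine tsum_of_norm_bounded h fun u => ?_
  rw [Real.norm_eq_abs, abs_mul, abs_of_nonneg (D.r_nonneg x u)]
  exact mul_le_mul_of_nonneg_left (D.abs_mix_le f x u) (D.r_nonneg x u)

variable [DiscreteTopology E]

/-- The transition operator of a jump mechanism. -/
noncomputable def op : (E →ᵇ ℝ) →L[ℝ] (E →ᵇ ℝ) :=
  LinearMap.mkContinuous
    { toFun := fun f => BoundedContinuousFunction.ofNormedAddCommGroupDiscrete
        (β := ℝ) (fun x : E => ∑' u, D.r x u * ((1 - D.a x u) * f x + D.a x u * f (D.T x u))) ‖f‖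
        (fun x => D.abs_tsum_mix_le f x)
      map_add' := fun f g => by
        ext x
        change ∑' u, D.r x u * ((1 - D.a x u) * (f x + g x) +
          D.a x u * (f (D.T x u) + g (D.T x u))) =
          ∑' u, D.r x u * ((1 - D.a x u) * f x + D.a x u * f (D.T x u)) +
          ∑' u, D.r x u * ((1 - D.a x u) * g x + D.a x u * g (D.T x u))
        rw [← (D.summable_mix f x).tsum_add (D.summable_mix g x)]
        exact tsum_congr fun u => by ring
      map_smul' := fun c f => by
        ext x
        change ∑' u, D.r x u * ((1 - D.a x u) * (c * f x) +
          D.a x u * (c * f (D.T x u))) =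
          c * ∑' u, D.r x u * ((1 - D.a x u) * f x + D.a x u * f (D.T x u))
        rw [← tsum_mul_left]
        exact tsum_congr fun u => by ring }
    1 fun f => by
      rw [one_mul]
      exact (BoundedContinuousFunction.norm_le (norm_nonneg f)).2 (D.abs_tsum_mix_le f)

theorem op_apply (f : E →ᵇ ℝ) (x : E) :
    D.op f x = ∑' u, D.r x u * ((1 - D.a x u) * f x + D.a x u * f (D.T x u)) := rfl

/-- The proposal weights sum to one, so the rejected moves cancel against `f x`. -/
theorem op_sub_apply (f : E →ᵇ ℝ) (x : E) :
    D.op f x - f x = ∑' u, D.r x u * (D.a x u * (f (D.T x u) - f x)) := by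
  have h : HasSum (fun u => D.r x u * f x) (1 * f x) := (D.r_sum x).mul_right _
  rw [one_mul] at h
  rw [op_apply]
  nth_rw 2 [← h.tsum_eq]
  rw [← (D.summable_mix f x).tsum_sub h.summable]
  exact tsum_congr fun u => by ring

theorem isPosOp : IsPosOp D.op := by
  intro f hf x
  refine tsum_nonneg fun u => mul_nonneg (D.r_nonneg x u) (add_nonneg ?_ ?_)
  · exact mul_nonneg (sub_nonneg.2 (D.a_le_one x u)) (hf x)
  · exact mul_nonneg (D.a_nonneg x u) (hf _)

theorem ofReal_op_apply (f : E →ᵇ ℝ) (hf : ∀ x, 0 ≤ f x) (x : E) :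
    ENNReal.ofReal (D.op f x) = ∑' u, (ENNReal.ofReal (D.r x u * (1 - D.a x u)) *
      ENNReal.ofReal (f x) + ENNReal.ofReal (D.r x u * D.a x u) *
        ENNReal.ofReal (f (D.T x u))) := by
  have h0 : ∀ u, 0 ≤ D.r x u * (1 - D.a x u) := fun u =>
    mul_nonneg (D.r_nonneg x u) (sub_nonneg.2 (D.a_le_one x u))
  have h1 : ∀ u, 0 ≤ D.r x u * D.a x u := fun u =>
    mul_nonneg (D.r_nonneg x u) (D.a_nonneg x u)
  rw [op_apply, ENNReal.ofReal_tsum_of_nonneg _ (D.summable_mix f x)]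
  · refine tsum_congr fun u => ?_
    rw [← ENNReal.ofReal_mul (h0 u), ← ENNReal.ofReal_mul (h1 u), ← ENNReal.ofReal_add
      (mul_nonneg (h0 u) (hf _)) (mul_nonneg (h1 u) (hf _))]
    congr 1
    ring
  · intro u
    have := add_nonneg (mul_nonneg (h0 u) (hf x)) (mul_nonneg (h1 u) (hf (D.T x u)))
    calc (0 : ℝ) ≤ _ := this
      _ = _ := by ring

/-- Detailed balance, with `inv x u` the move from `T x u` back to `x`, implies symmetry. -/
theorem isWeightSymm (inv : E → W → W) (hT : ∀ x u, D.T (D.T x u) (inv x u) = x)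
    (hinv : ∀ x u, inv (D.T x u) (inv x u) = u)
    (hw : ∀ x u, w x * ENNReal.ofReal (D.r x u * D.a x u) =
      w (D.T x u) * ENNReal.ofReal (D.r (D.T x u) (inv x u) * D.a (D.T x u) (inv x u))) :
    IsWeightSymm w D.op := by
  intro f g hf hg
  -- Reversing a move is an involution on pairs (state, move). It reindexes the accepted moves; the
  -- rejected ones are already symmetric in `f` and `g`.
  let e : E × W ≃ E × W :=
    { toFun := fun q => (D.T q.1 q.2, inv q.1 q.2)
      invFun := fun q => (D.T q.1 q.2, inv q.1 q.2)
      left_inv := fun q => Prod.ext (hT _ _) (hinv _ _)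
      right_inv := fun q => Prod.ext (hT _ _) (hinv _ _) }
  simp_rw [D.ofReal_op_apply f hf, D.ofReal_op_apply g hg, ← ENNReal.tsum_mul_left,
    ← ENNReal.tsum_mul_right, ← ENNReal.tsum_mul_left, mul_add, add_mul, mul_add,
    ENNReal.tsum_add]
  congr 1
  · exact tsum_congr fun x => tsum_congr fun u => by ring
  · rw [← ENNReal.tsum_prod, ← ENNReal.tsum_prod, ← e.tsum_eq]
    refine tsum_congr fun q => ?_
    change w (D.T q.1 q.2) * (ENNReal.ofReal (f (D.T q.1 q.2)) *
      (ENNReal.ofReal (D.r (D.T q.1 q.2) (inv q.1 q.2) * D.a (D.T q.1 q.2) (inv q.1 q.2)) *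
        ENNReal.ofReal (g (D.T (D.T q.1 q.2) (inv q.1 q.2))))) = _
    rw [hT]
    calc _ = (w (D.T q.1 q.2) * ENNReal.ofReal (D.r (D.T q.1 q.2) (inv q.1 q.2) *
          D.a (D.T q.1 q.2) (inv q.1 q.2))) * (ENNReal.ofReal (f (D.T q.1 q.2)) *
          ENNReal.ofReal (g q.1)) := by ring
      _ = _ := by rw [← hw]; ring

end JumpData

end Semigroup

/-! ### The single random walk as a semigroup -/

section Walk

open scoped BoundedContinuousFunction

variable {p : ℤ → ℤ → ℝ}

theorem IsJumpKernel.diag (hp : IsJumpKernel p) (x : ℤ) : p x x = 0 := by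
  rw [hp.translation, sub_self, hp.zero_diag]

/-- The jump mechanism of the discrete time walk. -/
def walkJump (hp : IsJumpKernel p) : JumpData ℤ ℤ where
  r := p
  a _ _ := 1
  T _ y := y
  r_nonneg := hp.nonneg
  r_sum := hp.hasSum_one
  a_nonneg _ _ := zero_le_one
  a_le_one _ _ := le_rfl

theorem walkJump_op_apply (hp : IsJumpKernel p) (f : ℤ →ᵇ ℝ) (x : ℤ) :
    (walkJump hp).op f x = ∑' y, p x y * f y := by
  rw [JumpData.op_apply]
  exact tsum_congr fun y => by simp [walkJump]

/-- Fubini for two kernels against a bounded function: the family on `ℤ × ℤ` is dominated by `r z *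
q z y * C`. -/
theorem hasSum_comm_mul {r : ℤ → ℝ} {q : ℤ → ℤ → ℝ} (hr : ∀ z, 0 ≤ r z) (hrs : Summable r)
    (hq : ∀ z y, 0 ≤ q z y) (hqs : ∀ z, HasSum (q z) 1) {f : ℤ → ℝ} {C : ℝ}
    (hf : ∀ y, |f y| ≤ C) :
    HasSum (fun y => (∑' z, r z * q z y) * f y) (∑' z, r z * ∑' y, q z y * f y) := by
  have hC : 0 ≤ C := (abs_nonneg _).trans (hf 0)
  have hS : Summable fun u : ℤ × ℤ => r u.1 * (q u.1 u.2 * f u.2) := by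
    refine Summable.of_norm_bounded (g := fun u : ℤ × ℤ => r u.1 * (q u.1 u.2 * C)) ?_ ?_
    · rw [summable_prod_of_nonneg fun u => mul_nonneg (hr _) (mul_nonneg (hq _ _) hC)]
      constructor
      · exact fun z => ((hqs z).summable.mul_right C).mul_left (r z)
      · have : ∀ z, ∑' y, r z * (q z y * C) = r z * C := fun z => by
          rw [(((hqs z).mul_right C).mul_left (r z)).tsum_eq, one_mul]
        simp_rw [this]
        exact hrs.mul_right C
    · intro u
      rw [Real.norm_eq_abs, abs_mul, abs_mul, abs_of_nonneg (hr _), abs_of_nonneg (hq _ _)]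
      exact mul_le_mul_of_nonneg_left (mul_le_mul_of_nonneg_left (hf _) (hq _ _)) (hr _)
  have h1 := hS.tsum_prod
  have h2 : Summable fun u : ℤ × ℤ => r u.2 * (q u.2 u.1 * f u.1) :=
    ((Equiv.prodComm ℤ ℤ).summable_iff (f := fun u : ℤ × ℤ => r u.1 * (q u.1 u.2 * f u.2))).2 hS
  have h3 := h2.hasSum.prod_fiberwise fun y => (h2.prod_factor y).hasSum
  have h4 : ∑' u : ℤ × ℤ, r u.2 * (q u.2 u.1 * f u.1) =
      ∑' u : ℤ × ℤ, r u.1 * (q u.1 u.2 * f u.2) :=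
    (Equiv.prodComm ℤ ℤ).tsum_eq (fun u : ℤ × ℤ => r u.1 * (q u.1 u.2 * f u.2))
  rw [h4, h1] at h3
  convert h3 using 1
  · ext y
    rw [← tsum_mul_right]
    exact tsum_congr fun z => by ring
  · exact tsum_congr fun z => tsum_mul_left.symm

theorem stepProb_nonneg (hp : IsJumpKernel p) (n : ℕ) (x y : ℤ) : 0 ≤ stepProb p n x y := by
  induction n generalizing x with
  | zero => rw [stepProb]; split_ifs <;> norm_num
  | succ n ih => exact tsum_nonneg fun z => mul_nonneg (hp.nonneg _ _) (ih z)

theorem hasSum_stepProb (hp : IsJumpKernel p) (n : ℕ) (x : ℤ) :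
    HasSum (stepProb p n x) 1 := by
  induction n generalizing x with
  | zero =>
    convert hasSum_ite_eq x (1 : ℝ) using 2 with y
    simp [stepProb, eq_comm]
  | succ n ih =>
    have h := hasSum_comm_mul (hp.nonneg x) (hp.hasSum_one x).summable (stepProb_nonneg hp n) ih
      (f := fun _ => 1) (C := 1) (by simp)
    simpa [(ih _).tsum_eq, (hp.hasSum_one x).tsum_eq, stepProb] using h

theorem hasSum_stepProb_mul (hp : IsJumpKernel p) (f : ℤ →ᵇ ℝ) (n : ℕ) (x : ℤ) :
    HasSum (fun y => stepProb p n x y * f y) (((walkJump hp).op ^ n) f x) := by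
  induction n generalizing x with
  | zero =>
    convert hasSum_ite_eq x (f x) using 2 with y
    by_cases h : y = x
    · simp [stepProb, h]
    · simp [stepProb, h, Ne.symm h]
    · rw [pow_zero]; rfl
  | succ n ih =>
    have h := hasSum_comm_mul (hp.nonneg x) (hp.hasSum_one x).summable (stepProb_nonneg hp n)
      (hasSum_stepProb hp n) (fun y => f.norm_coe_le_norm y)
    have h2 : ((walkJump hp).op ^ (n + 1)) f x =
        (walkJump hp).op (((walkJump hp).op ^ n) f) x := by rw [pow_succ']; rfl
    rw [h2, walkJump_op_apply]
    simp_rw [← (ih _).tsum_eq]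
    exact h

open Classical in
/-- The indicator function of a set of sites. -/
noncomputable def siteInd (B : Set ℝ) : ℤ →ᵇ ℝ :=
  BoundedContinuousFunction.ofNormedAddCommGroupDiscrete (β := ℝ)
    (fun y : ℤ => if (y : ℝ) ∈ B then 1 else 0) 1 fun y => by split_ifs <;> simp

open Classical in
theorem siteInd_apply (B : Set ℝ) (y : ℤ) :
    siteInd B y = if (y : ℝ) ∈ B then 1 else 0 := rfl

theorem siteInd_nonneg (B : Set ℝ) (y : ℤ) : 0 ≤ siteInd B y := by
  rw [siteInd_apply]; split_ifs <;> norm_num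

/-- The function `x ↦ P_x(ζ_t ∈ B)`. -/
noncomputable def walkFun (hp : IsJumpKernel p) (B : Set ℝ) (t : ℝ) : ℤ →ᵇ ℝ :=
  semi (walkJump hp).op 1 t (siteInd B)

/-- The Poisson mixture of step probabilities is the exponential series of the one-step operator,
with `exp (-t)` coming from the `- 1` in the generator. -/
theorem walkProb_eq (hp : IsJumpKernel p) (t : ℝ) (x : ℤ) (B : Set ℝ) :
    walkProb p t x B = walkFun hp B t x := by
  have h := (hasSum_flow_eval (walkJump hp).op t (siteInd B) x).mul_left (Real.exp (-t))
  have h2 : walkFun hp B t x = Real.exp (-t) * flow (walkJump hp).op t (siteInd B) x := by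
    rw [walkFun, semi_eq, one_mul]; rfl
  rw [h2, ← h.tsum_eq, walkProb]
  refine tsum_congr fun n => ?_
  rw [← (hasSum_stepProb_mul hp (siteInd B) n x).tsum_eq, mul_div_assoc, mul_assoc]
  congr 2
  refine tsum_congr fun y => ?_
  rw [siteInd_apply]
  split_ifs <;> simp

theorem walkFun_nonneg (hp : IsJumpKernel p) (B : Set ℝ) {t : ℝ} (ht : 0 ≤ t) (x : ℤ) :
    0 ≤ walkFun hp B t x :=
  (walkJump hp).isPosOp.semi_op 1 ht _ (siteInd_nonneg B) x

theorem walkFun_zero (hp : IsJumpKernel p) (B : Set ℝ) : walkFun hp B 0 = siteInd B := by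
  rw [walkFun, semi, flow_zero]; rfl

theorem continuous_walkFun (hp : IsJumpKernel p) (B : Set ℝ) : Continuous (walkFun hp B) :=
  continuous_semi _ _ _

theorem hasDerivAt_walkFun (hp : IsJumpKernel p) (B : Set ℝ) (t : ℝ) :
    HasDerivAt (walkFun hp B) ((walkJump hp).op (walkFun hp B t) - walkFun hp B t) t := by
  have h := hasDerivAt_flow_apply ((walkJump hp).op - (1 : ℝ) • 1) t (siteInd B)
  rw [one_smul] at h
  have : walkFun hp B = fun s => flow ((walkJump hp).op - 1) s (siteInd B) := by
    ext1 s; rw [walkFun, semi, one_smul]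
  rw [this]
  exact h

theorem isWeightSymm_walk (hp : IsJumpKernel p) :
    IsWeightSymm (fun _ => 1) (walkJump hp).op := by
  refine (walkJump hp).isWeightSymm (fun x _ => x) (fun _ _ => rfl) (fun _ _ => rfl) ?_
  intro x y
  simp [walkJump, hp.symm x y]

/-- Chapman-Kolmogorov and symmetry. -/
theorem tsum_walkFun_mul (hp : IsJumpKernel p) (A B : Set ℝ) {r s : ℝ} (hr : 0 ≤ r)
    (hs : 0 ≤ s) :
    ∑' y, ENNReal.ofReal (walkFun hp A r y) * ENNReal.ofReal (walkFun hp B s y) =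
      ∑' y, ENNReal.ofReal (siteInd A y) * ENNReal.ofReal (walkFun hp B (r + s) y) := by
  have h := (isWeightSymm_walk hp).semi_op (walkJump hp).isPosOp 1 hr (siteInd A)
    (walkFun hp B s) (siteInd_nonneg A) (walkFun_nonneg hp B hs)
  have h2 : semi (walkJump hp).op 1 r (walkFun hp B s) = walkFun hp B (r + s) := by
    rw [walkFun, walkFun, semi, semi, semi, flow_add]; rfl
  simp only [one_mul, h2] at h
  exact h.symm

end Walk

/-! ### Multiplicities in tuples and products of falling factorials -/

section Counting

variable {M : ℕ}

/-- The number of coordinates of `x` at the site `u`. -/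
def occ (x : Fin M → ℤ) (u : ℤ) : ℕ := (Finset.univ.filter fun j => x j = u).card

/-- The number of coordinates of `x` other than the `i`-th at the site `u`. -/
def occOff (x : Fin M → ℤ) (i : Fin M) (u : ℤ) : ℕ :=
  (Finset.univ.filter fun j => j ≠ i ∧ x j = u).card

theorem occ_eq_occOff_add (x : Fin M → ℤ) (i : Fin M) (u : ℤ) :
    occ x u = occOff x i u + if x i = u then 1 else 0 := by
  have h : (Finset.univ.filter fun j => x j = u) =
      (Finset.univ.filter fun j => j ≠ i ∧ x j = u) ∪
        (if x i = u then {i} else ∅) := by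
    ext j
    split_ifs with hi
    · by_cases hj : j = i <;> simp [hj, hi]
    · by_cases hj : j = i <;> simp [hj, hi]
  rw [occ, h, Finset.card_union_of_disjoint, occOff]
  · split_ifs <;> simp
  · split_ifs <;> simp

theorem occOff_update (x : Fin M → ℤ) (i : Fin M) (y : ℤ) :
    occOff (Function.update x i y) i = occOff x i := by
  funext u
  unfold occOff
  congr 1
  ext j
  by_cases hj : j = i <;> simp [hj]

theorem occ_update_of_ne (x : Fin M → ℤ) (i : Fin M) (y u : ℤ) (h1 : u ≠ y) (h2 : u ≠ x i) :
    occ (Function.update x i y) u = occ x u := by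
  rw [occ_eq_occOff_add _ i, occOff_update, occ_eq_occOff_add x i]
  simp [h1.symm, h2.symm]

theorem occ_update_self (x : Fin M → ℤ) (i : Fin M) (y : ℤ) (h : y ≠ x i) :
    occ (Function.update x i y) y = occ x y + 1 := by
  rw [occ_eq_occOff_add _ i, occOff_update, occ_eq_occOff_add x i]
  simp [h.symm]

theorem occ_update_old (x : Fin M → ℤ) (i : Fin M) (y : ℤ) (h : y ≠ x i) :
    occ (Function.update x i y) (x i) + 1 = occ x (x i) := by
  rw [occ_eq_occOff_add _ i, occOff_update, occ_eq_occOff_add x i]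
  simp [h]

theorem occOff_eq_occ (x : Fin M → ℤ) (i : Fin M) (y : ℤ) (h : y ≠ x i) :
    occOff x i y = occ x y := by
  rw [occ_eq_occOff_add x i, if_neg h.symm, add_zero]

theorem occ_pos (x : Fin M → ℤ) (i : Fin M) : 0 < occ x (x i) :=
  Finset.card_pos.2 ⟨i, by simp⟩

theorem occ_eq_zero {x : Fin M → ℤ} {u : ℤ} (h : u ∉ Finset.univ.image x) : occ x u = 0 := by
  rw [occ, Finset.card_eq_zero, Finset.filter_eq_empty_iff]
  intro j _ hj
  exact h (Finset.mem_image.2 ⟨j, Finset.mem_univ _, hj⟩)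

theorem occ_eq_sum (x : Fin M → ℤ) (u : ℤ) : (occ x u : ℝ) = ∑ j, if x j = u then (1 : ℝ) else 0 := by
  rw [occ]; simp

/-- The product over the sites of the falling factorials of `η` of the order given by the
multiplicities in `x`. -/
noncomputable def facProd (η : ℤ → ℕ) (x : Fin M → ℤ) : ℕ :=
  ∏ᶠ u, (η u).descFactorial (occ x u)

/-- The product `facProd`, with the `i`-th coordinate left out. -/
noncomputable def facOff (η : ℤ → ℕ) (x : Fin M → ℤ) (i : Fin M) : ℕ :=
  ∏ᶠ u, (η u).descFactorial (occOff x i u)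

theorem facProd_eq_prod (η : ℤ → ℕ) (x : Fin M → ℤ) {U : Finset ℤ}
    (hU : Finset.univ.image x ⊆ U) :
    facProd η x = ∏ u ∈ U, (η u).descFactorial (occ x u) := by
  refine finprod_eq_prod_of_mulSupport_subset _ fun u hu => ?_
  by_contra h
  apply hu
  simp only [occ_eq_zero fun h' => h (hU h'), Nat.descFactorial_zero]

/-- Removing coordinate `i` lowers the order of one falling factorial by one, at the site `x i`. As
`facOff` does not see the position of coordinate `i`, this compares a tuple with the one after a
jump of `i`. -/
theorem facProd_eq_facOff_mul (η : ℤ → ℕ) (x : Fin M → ℤ) (i : Fin M) :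
    facProd η x = facOff η x i * (η (x i) - occOff x i (x i)) := by
  have h2 : facOff η x i = ∏ u ∈ Finset.univ.image x, (η u).descFactorial (occOff x i u) := by
    refine finprod_eq_prod_of_mulSupport_subset _ fun u hu => ?_
    by_contra h
    apply hu
    have := occ_eq_occOff_add x i u
    rw [occ_eq_zero h] at this
    simp [show occOff x i u = 0 by omega]
  have hi : x i ∈ Finset.univ.image x := Finset.mem_image_of_mem _ (Finset.mem_univ i)
  rw [h2, facProd_eq_prod η x subset_rfl, ← Finset.mul_prod_erase _ _ hi,
    ← Finset.mul_prod_erase _ (fun u => (η u).descFactorial (occOff x i u)) hi]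
  have h3 : ∏ u ∈ (Finset.univ.image x).erase (x i), (η u).descFactorial (occ x u) =
      ∏ u ∈ (Finset.univ.image x).erase (x i), (η u).descFactorial (occOff x i u) := by
    refine Finset.prod_congr rfl fun u hu => ?_
    rw [occOff_eq_occ x i u (Finset.ne_of_mem_erase hu)]
  rw [h3, occ_eq_occOff_add x i (x i), if_pos rfl, Nat.descFactorial_succ]
  ring

theorem facOff_update (η : ℤ → ℕ) (x : Fin M → ℤ) (i : Fin M) (y : ℤ) :
    facOff η (Function.update x i y) i = facOff η x i := by
  unfold facOff
  rw [occOff_update]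

theorem facProd_update (η : ℤ → ℕ) (x : Fin M → ℤ) (i : Fin M) {y : ℤ} (h : y ≠ x i) :
    facProd η (Function.update x i y) = facOff η x i * (η y - occ x y) := by
  rw [facProd_eq_facOff_mul _ _ i, facOff_update, occOff_update, Function.update_self,
    occOff_eq_occ x i y h]

theorem facProd_ne_zero_iff (η : ℤ → ℕ) (x : Fin M → ℤ) :
    facProd η x ≠ 0 ↔ ∀ u, occ x u ≤ η u := by
  rw [facProd_eq_prod η x subset_rfl, Finset.prod_ne_zero_iff]
  simp only [ne_eq, Nat.descFactorial_eq_zero_iff_lt, not_lt]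
  refine ⟨fun h u => ?_, fun h u _ => h u⟩
  by_cases hu : u ∈ Finset.univ.image x
  · exact h u hu
  · rw [occ_eq_zero hu]; exact Nat.zero_le _

theorem facProd_mono {η ζ : ℤ → ℕ} (h : ∀ u, η u ≤ ζ u) (x : Fin M → ℤ) :
    facProd η x ≤ facProd ζ x := by
  rw [facProd_eq_prod η x subset_rfl, facProd_eq_prod ζ x subset_rfl]
  refine Finset.prod_le_prod' fun u _ => ?_
  exact Nat.descFactorial_le _ (h u)

end Counting

/-! ### Exclusion dynamics on tuples and comparison with independent walks -/

section Exclusion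

open scoped BoundedContinuousFunction

variable {p : ℤ → ℤ → ℝ} {M K : ℕ}

/-- The reversible weight of the exclusion dynamics on tuples. -/
noncomputable def exclWeight (K : ℕ) (x : Fin M → ℤ) : ℕ := facProd (fun _ => K) x

/-- The probability that a jump to `y` is not blocked. -/
noncomputable def acceptProb (K : ℕ) (x : Fin M → ℤ) (y : ℤ) : ℝ :=
  if exclWeight K x = 0 then 0 else ((K - occ x y : ℕ) : ℝ) / K

theorem acceptProb_nonneg (x : Fin M → ℤ) (y : ℤ) : 0 ≤ acceptProb K x y := by
  rw [acceptProb]; split_ifs <;> positivity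

theorem acceptProb_le_one (x : Fin M → ℤ) (y : ℤ) : acceptProb K x y ≤ 1 := by
  rw [acceptProb]
  split_ifs
  · exact zero_le_one
  · exact div_le_one_of_le₀ (by exact_mod_cast Nat.sub_le _ _) (by positivity)

/-- The jump mechanism of the `i`-th of `M` particles in exclusion interaction. -/
noncomputable def exclJump (hp : IsJumpKernel p) (K : ℕ) (i : Fin M) :
    JumpData (Fin M → ℤ) ℤ where
  r x y := p (x i) y
  a x y := acceptProb K x y
  T x y := Function.update x i y
  r_nonneg _ _ := hp.nonneg _ _
  r_sum x := hp.hasSum_one (x i)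
  a_nonneg x y := acceptProb_nonneg x y
  a_le_one x y := acceptProb_le_one x y

/-- Detailed balance: both sides equal `facOff` times the free room at the old and at the new site,
counted without particle `i`, over `K`. This is symmetric in the two sites. -/
theorem exclWeight_mul_acceptProb (x : Fin M → ℤ) (i : Fin M) {y : ℤ} (h : y ≠ x i) :
    (exclWeight K x : ℝ) * acceptProb K x y =
      exclWeight K (Function.update x i y) * acceptProb K (Function.update x i y) (x i) := by
  have key : ∀ (x : Fin M → ℤ) (y : ℤ), y ≠ x i →
      (exclWeight K x : ℝ) * acceptProb K x y =
        (facOff (fun _ => K) x i : ℝ) * ((K - occOff x i (x i) : ℕ) : ℝ) *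
          ((K - occOff x i y : ℕ) : ℝ) / K := by
    intro x y h
    have h1 : (exclWeight K x : ℝ) =
        (facOff (fun _ => K) x i : ℝ) * ((K - occOff x i (x i) : ℕ) : ℝ) := by
      exact_mod_cast facProd_eq_facOff_mul (fun _ => K) x i
    rw [← h1, acceptProb, occOff_eq_occ x i y h]
    split_ifs with h0
    · simp [h0]
    · ring
  rw [key x y h, key _ (x i) (by simpa using h.symm), facOff_update, occOff_update,
    Function.update_self]
  ring

theorem isWeightSymm_exclJump (hp : IsJumpKernel p) (i : Fin M) :
    IsWeightSymm (fun x => (exclWeight K x : ℝ≥0∞)) (exclJump hp K i).op := by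
  refine (exclJump hp K i).isWeightSymm (fun x _ => x i) ?_ ?_ ?_
  · intro x y; simp [exclJump]
  · intro x y; simp [exclJump]
  · intro x y
    change (exclWeight K x : ℝ≥0∞) * ENNReal.ofReal (p (x i) y * acceptProb K x y) =
      (exclWeight K (Function.update x i y) : ℝ≥0∞) *
        ENNReal.ofReal (p (Function.update x i y i) (x i) *
          acceptProb K (Function.update x i y) (x i))
    rw [Function.update_self]
    rcases eq_or_ne y (x i) with rfl | h
    · rw [hp.diag]; simp
    · rw [← ENNReal.ofReal_natCast, ← ENNReal.ofReal_natCast, ← ENNReal.ofReal_mul (by positivity),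
        ← ENNReal.ofReal_mul (by positivity)]
      congr 1
      rw [mul_left_comm, exclWeight_mul_acceptProb x i h, hp.symm (x i) y]
      ring

/-- The (unnormalised) transition operator of `M` particles in exclusion interaction. -/
noncomputable def exclOp (hp : IsJumpKernel p) (M K : ℕ) :
    ((Fin M → ℤ) →ᵇ ℝ) →L[ℝ] ((Fin M → ℤ) →ᵇ ℝ) :=
  ∑ i : Fin M, (exclJump hp K i).op

theorem isPosOp_exclOp (hp : IsJumpKernel p) : IsPosOp (exclOp hp M K) :=
  IsPosOp.sum _ fun i _ => (exclJump hp K i).isPosOp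

theorem isWeightSymm_exclOp (hp : IsJumpKernel p) :
    IsWeightSymm (fun x => (exclWeight K x : ℝ≥0∞)) (exclOp hp M K) :=
  IsWeightSymm.sum _ (fun i _ => (exclJump hp K i).isPosOp)
    fun i _ => isWeightSymm_exclJump hp i

/-- The generator of `M` particles in exclusion interaction, in the time scale in which a
single particle jumps at rate one. -/
noncomputable def exclGen (hp : IsJumpKernel p) (M K : ℕ) :
    ((Fin M → ℤ) →ᵇ ℝ) →L[ℝ] ((Fin M → ℤ) →ᵇ ℝ) :=
  exclOp hp M K - (M : ℝ) • 1

theorem exclGen_apply (hp : IsJumpKernel p) (f : (Fin M → ℤ) →ᵇ ℝ) (x : Fin M → ℤ) :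
    exclGen hp M K f x = ∑ i, ∑' y, p (x i) y *
      (acceptProb K x y * (f (Function.update x i y) - f x)) := by
  have h : exclGen hp M K f x = (∑ i, (exclJump hp K i).op f x) - M * f x := by
    simp [exclGen, exclOp]
  have h2 : (M : ℝ) * f x = ∑ _i : Fin M, f x := by simp
  rw [h, h2, ← Finset.sum_sub_distrib]
  exact Finset.sum_congr rfl fun i _ => (exclJump hp K i).op_sub_apply f x

/-- The semigroup of `M` particles in exclusion interaction. -/
noncomputable def exclSemi (hp : IsJumpKernel p) (M K : ℕ) (t : ℝ) :
    ((Fin M → ℤ) →ᵇ ℝ) →L[ℝ] ((Fin M → ℤ) →ᵇ ℝ) :=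
  semi (exclOp hp M K) M t

theorem exclSemi_eq_flow (hp : IsJumpKernel p) (M K : ℕ) :
    exclSemi hp M K = flow (exclGen hp M K) := rfl

/-- The indicator of the tuples that are compatible with the exclusion rule. -/
noncomputable def admInd (M K : ℕ) : (Fin M → ℤ) →ᵇ ℝ :=
  BoundedContinuousFunction.ofNormedAddCommGroupDiscrete (β := ℝ)
    (fun x => if exclWeight K x = 0 then 0 else 1) 1 fun x => by split_ifs <;> simp

theorem admInd_apply (x : Fin M → ℤ) :
    admInd M K x = if exclWeight K x = 0 then 0 else 1 := rfl

/-- Composition with the `j`-th coordinate. -/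
noncomputable def coordCLM (j : Fin M) : (ℤ →ᵇ ℝ) →L[ℝ] ((Fin M → ℤ) →ᵇ ℝ) :=
  LinearMap.mkContinuous
    { toFun := fun h => h.compContinuous ⟨fun x => x j, continuous_apply j⟩
      map_add' := fun _ _ => rfl
      map_smul' := fun _ _ => rfl }
    1 fun h => by
      rw [one_mul]
      exact (BoundedContinuousFunction.norm_le (norm_nonneg h)).2
        fun x => h.norm_coe_le_norm (x j)

/-- The product function `x ↦ ∏ h (x j)`. -/
noncomputable def prodFun (M : ℕ) (h : ℤ →ᵇ ℝ) : (Fin M → ℤ) →ᵇ ℝ := ∏ j, coordCLM j h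

theorem bcf_prod_apply {E ι : Type*} [TopologicalSpace E] (s : Finset ι) (f : ι → E →ᵇ ℝ) (x : E) :
    (∏ j ∈ s, f j) x = ∏ j ∈ s, f j x := by
  induction s using Finset.cons_induction with
  | empty => simp
  | cons a s ha ih => rw [Finset.prod_cons, Finset.prod_cons, ← ih]; rfl

theorem prodFun_apply (h : ℤ →ᵇ ℝ) (x : Fin M → ℤ) : prodFun M h x = ∏ j, h (x j) :=
  bcf_prod_apply _ _ _

/-- The derivative of `∏ h (x j)` when `h` evolves as the single walk. -/
noncomputable def prodDeriv (hp : IsJumpKernel p) (M : ℕ) (h : ℤ →ᵇ ℝ) : (Fin M → ℤ) →ᵇ ℝ :=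
  ∑ i, (∏ j ∈ Finset.univ.erase i, coordCLM j h) * coordCLM i ((walkJump hp).op h - h)

/-- The source term in the comparison of independent and exclusion particles. -/
noncomputable def source (hp : IsJumpKernel p) (M K : ℕ) (h : ℤ →ᵇ ℝ) : (Fin M → ℤ) →ᵇ ℝ :=
  admInd M K * prodDeriv hp M h - exclGen hp M K (admInd M K * prodFun M h)

theorem hasDerivAt_prodFun (hp : IsJumpKernel p) (M : ℕ) (B : Set ℝ) (t : ℝ) :
    HasDerivAt (fun s => prodFun M (walkFun hp B s)) (prodDeriv hp M (walkFun hp B t)) t := by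
  have h := HasDerivAt.fun_finsetProd (u := Finset.univ) (x := t)
    (f := fun (j : Fin M) s => coordCLM j (walkFun hp B s))
    (f' := fun j => coordCLM j ((walkJump hp).op (walkFun hp B t) - walkFun hp B t))
    fun j _ => (coordCLM j).hasFDerivAt.comp_hasDerivAt t (hasDerivAt_walkFun hp B t)
  exact h

theorem continuous_prodFun (hp : IsJumpKernel p) (M : ℕ) (B : Set ℝ) :
    Continuous fun s => prodFun M (walkFun hp B s) :=
  continuous_iff_continuousAt.2 fun t => (hasDerivAt_prodFun hp M B t).continuousAt

theorem continuous_source (hp : IsJumpKernel p) (M K : ℕ) (B : Set ℝ) :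
    Continuous fun s => source hp M K (walkFun hp B s) := by
  unfold source prodDeriv
  have h := continuous_walkFun hp B
  have h2 := continuous_prodFun hp M B
  refine (continuous_const.mul (continuous_finsetSum _ fun i _ => ?_)).sub
    ((exclGen hp M K).continuous.comp (continuous_const.mul h2))
  refine (continuous_finsetProd _ fun j _ => (coordCLM j).continuous.comp h).mul
    ((coordCLM i).continuous.comp (((walkJump hp).op.continuous.comp h).sub h))

theorem prodFun_update (h : ℤ →ᵇ ℝ) (x : Fin M → ℤ) (i : Fin M) (y : ℤ) :
    prodFun M h (Function.update x i y) = h y * ∏ j ∈ Finset.univ.erase i, h (x j) := by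
  rw [prodFun_apply, ← Finset.mul_prod_erase _ _ (Finset.mem_univ i), Function.update_self]
  congr 1
  exact Finset.prod_congr rfl fun j hj => by
    rw [Function.update_of_ne (Finset.ne_of_mem_erase hj)]

/-- The ordered pairs `(i, j)` and `(j, i)` combine by symmetry of `p` and `(h j - h i) * h j + (h i
- h j) * h i = (h i - h j) ^ 2`. -/
theorem sum_pairs (x : Fin M → ℤ) (h : ℤ → ℝ) (hp : IsJumpKernel p) :
    ∑ i, (∏ l ∈ Finset.univ.erase i, h (x l)) * ∑ j, p (x i) (x j) * (h (x j) - h (x i)) =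
      ∑ i, ∑ j ∈ Finset.Ioi i, p (x i) (x j) * (h (x i) - h (x j)) ^ 2 *
        ∏ l ∈ (Finset.univ.erase i).erase j, h (x l) := by
  have h1 := Finset.sum_sum_Ioi_add_eq_sum_sum_off_diag
    (fun j i : Fin M => (∏ l ∈ Finset.univ.erase i, h (x l)) *
      (p (x i) (x j) * (h (x j) - h (x i))))
  have h2 : ∀ i : Fin M, (∏ l ∈ Finset.univ.erase i, h (x l)) *
      ∑ j, p (x i) (x j) * (h (x j) - h (x i)) =
      ∑ j ∈ {i}ᶜ, (∏ l ∈ Finset.univ.erase i, h (x l)) *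
        (p (x i) (x j) * (h (x j) - h (x i))) := by
    intro i
    rw [Finset.mul_sum, ← Finset.add_sum_erase _ _ (Finset.mem_univ i)]
    simp [Finset.compl_singleton]
  simp_rw [h2]
  rw [← h1]
  refine Finset.sum_congr rfl fun i _ => Finset.sum_congr rfl fun j hj => ?_
  have hij : i ≠ j := (Finset.mem_Ioi.1 hj).ne
  rw [← Finset.mul_prod_erase (Finset.univ.erase i) (fun l => h (x l))
      (Finset.mem_erase.2 ⟨hij.symm, Finset.mem_univ j⟩),
    ← Finset.mul_prod_erase (Finset.univ.erase j) (fun l => h (x l))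
      (Finset.mem_erase.2 ⟨hij, Finset.mem_univ i⟩), Finset.erase_right_comm (a := j),
    hp.symm (x j) (x i)]
  ring

/-- Coordinate `i` contributes the jumps suppressed by exclusion. A jump to `y` is blocked with
probability `occ x y / K`, so the sum over targets collapses to a sum over the positions of the
coordinates, to which `sum_pairs` applies. -/
theorem source_apply (hp : IsJumpKernel p) (hK : 1 ≤ K) (h : ℤ →ᵇ ℝ) (x : Fin M → ℤ) :
    source hp M K h x = admInd M K x * ((K : ℝ)⁻¹ * ∑ i, ∑ j ∈ Finset.Ioi i,
      p (x i) (x j) * (h (x i) - h (x j)) ^ 2 *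
        ∏ l ∈ (Finset.univ.erase i).erase j, h (x l)) := by
  have hs : source hp M K h x = admInd M K x * prodDeriv hp M h x -
      exclGen hp M K (admInd M K * prodFun M h) x := rfl
  rw [hs, exclGen_apply]
  -- Inadmissible tuples are frozen, since `acceptProb` is set to `0` there, and both terms of
  -- `source` vanish.
  by_cases h0 : exclWeight K x = 0
  · simp [admInd_apply, acceptProb, h0]
  have hocc : ∀ u, occ x u ≤ K := (facProd_ne_zero_iff _ x).1 h0
  have hKr : (K : ℝ) ≠ 0 := by positivity
  rw [← sum_pairs x h hp, admInd_apply, if_neg h0, one_mul, one_mul, prodDeriv,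
    BoundedContinuousFunction.sum_apply, ← Finset.sum_sub_distrib, Finset.mul_sum]
  refine Finset.sum_congr rfl fun i _ => ?_
  have h1 : ((∏ j ∈ Finset.univ.erase i, coordCLM j h) *
      coordCLM i ((walkJump hp).op h - h)) x =
      (∏ l ∈ Finset.univ.erase i, h (x l)) * ((walkJump hp).op h (x i) - h (x i)) := by
    rw [BoundedContinuousFunction.coe_mul, Pi.mul_apply, bcf_prod_apply]; rfl
  have h2 : (walkJump hp).op h (x i) - h (x i) = ∑' y, p (x i) y * (h y - h (x i)) := by
    rw [JumpData.op_sub_apply]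
    exact tsum_congr fun y => by simp [walkJump]
  have h3 : ∀ y, p (x i) y * (acceptProb K x y *
      ((admInd M K * prodFun M h) (Function.update x i y) - (admInd M K * prodFun M h) x)) =
      (∏ l ∈ Finset.univ.erase i, h (x l)) *
        (p (x i) y * (acceptProb K x y * (h y - h (x i)))) := by
    intro y
    rcases eq_or_ne y (x i) with rfl | hy
    · rw [hp.diag]; ring
    have hx : (admInd M K * prodFun M h) x =
        h (x i) * ∏ l ∈ Finset.univ.erase i, h (x l) := by
      have := prodFun_update h x i (x i)
      rw [Function.update_eq_self] at this
      rw [← this, BoundedContinuousFunction.coe_mul, Pi.mul_apply, admInd_apply, if_neg h0,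
        one_mul]
    -- A move with positive acceptance probability leads from an admissible tuple to an admissible
    -- one.
    have ha : acceptProb K x y * admInd M K (Function.update x i y) = acceptProb K x y := by
      rw [admInd_apply]
      split_ifs with hz
      · rw [exclWeight, facProd_update _ _ _ hy, Nat.mul_eq_zero] at hz
        have h5 : facOff (fun _ => K) x i ≠ 0 := fun h6 => h0 (by
          rw [exclWeight, facProd_eq_facOff_mul _ _ i, h6, zero_mul])
        rw [acceptProb, if_neg h0, hz.resolve_left h5]
        simp
      · rw [mul_one]
    rw [hx, BoundedContinuousFunction.coe_mul, Pi.mul_apply, prodFun_update]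
    linear_combination (p (x i) y * (h y * ∏ l ∈ Finset.univ.erase i, h (x l))) * ha
  simp_rw [h3]
  rw [h1, h2, tsum_mul_left, ← mul_sub]
  have hb : ∀ y, |h y - h (x i)| ≤ 2 * ‖h‖ := fun y => by
    have e1 := h.norm_coe_le_norm y
    have e2 := h.norm_coe_le_norm (x i)
    rw [Real.norm_eq_abs] at e1 e2
    calc _ ≤ |h y| + |h (x i)| := abs_sub _ _
      _ ≤ _ := by linarith
  have s1 : Summable fun y => p (x i) y * (h y - h (x i)) :=
    (walkJump hp).summable_mul (x i) hb
  have s2 : Summable fun y => p (x i) y * (acceptProb K x y * (h y - h (x i))) := by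
    refine (walkJump hp).summable_mul (x i) (C := 2 * ‖h‖) fun y => ?_
    rw [abs_mul, abs_of_nonneg (acceptProb_nonneg x y)]
    exact (mul_le_of_le_one_left (abs_nonneg _) (acceptProb_le_one x y)).trans (hb y)
  rw [← s1.tsum_sub s2]
  have h4 : ∀ y, p (x i) y * (h y - h (x i)) -
      p (x i) y * (acceptProb K x y * (h y - h (x i))) =
      ∑ j, if y = x j then (K : ℝ)⁻¹ * (p (x i) (x j) * (h (x j) - h (x i))) else 0 := by
    intro y
    have e1 : acceptProb K x y = 1 - (K : ℝ)⁻¹ * occ x y := by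
      rw [acceptProb, if_neg h0, Nat.cast_sub (hocc y)]
      field_simp
    have e2 : ∀ j, (if y = x j then (K : ℝ)⁻¹ * (p (x i) (x j) * (h (x j) - h (x i))) else 0) =
        (if x j = y then (1 : ℝ) else 0) * ((K : ℝ)⁻¹ * (p (x i) y * (h y - h (x i)))) := by
      intro j
      by_cases hj : x j = y
      · subst hj; simp
      · simp [hj, Ne.symm hj]
    rw [Finset.sum_congr rfl fun j _ => e2 j, ← Finset.sum_mul, ← occ_eq_sum, e1]
    ring
  simp_rw [h4]
  rw [Summable.tsum_finsetSum fun j _ => (hasSum_ite_eq (x j) _).summable]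
  simp_rw [tsum_ite_eq, ← Finset.mul_sum]
  ring

theorem source_nonneg (hp : IsJumpKernel p) (hK : 1 ≤ K) {h : ℤ →ᵇ ℝ} (hh : ∀ y, 0 ≤ h y)
    (x : Fin M → ℤ) : 0 ≤ source hp M K h x := by
  rw [source_apply hp hK]
  refine mul_nonneg ?_ (mul_nonneg (by positivity) (Finset.sum_nonneg fun i _ =>
    Finset.sum_nonneg fun j _ => mul_nonneg (mul_nonneg (hp.nonneg _ _) (sq_nonneg _))
      (Finset.prod_nonneg fun l _ => hh _)))
  rw [admInd_apply]; split_ifs <;> norm_num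

/-- Independent particles versus particles in exclusion interaction. -/
theorem admInd_mul_prodFun_eq (hp : IsJumpKernel p) (M K : ℕ) (B : Set ℝ) {t : ℝ} (ht : 0 ≤ t)
    (x : Fin M → ℤ) :
    admInd M K x * prodFun M (walkFun hp B t) x =
      exclSemi hp M K t (admInd M K * prodFun M (siteInd B)) x +
        ∫ s in (0 : ℝ)..t, exclSemi hp M K (t - s) (source hp M K (walkFun hp B s)) x := by
  have hc : Continuous fun s : ℝ => exclSemi hp M K (t - s) (source hp M K (walkFun hp B s)) := by
    rw [exclSemi_eq_flow]
    exact ((continuous_flow _).comp (continuous_const.sub continuous_id)).clm_apply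
      (continuous_source hp M K B)
  have hd : ∀ s, HasDerivAt (fun s => admInd M K * prodFun M (walkFun hp B s))
      (exclGen hp M K (admInd M K * prodFun M (walkFun hp B s)) +
        source hp M K (walkFun hp B s)) s := by
    intro s
    have h1 := (hasDerivAt_prodFun hp M B s).const_mul (admInd M K)
    have h2 : exclGen hp M K (admInd M K * prodFun M (walkFun hp B s)) +
        source hp M K (walkFun hp B s) = admInd M K * prodDeriv hp M (walkFun hp B s) :=
      add_sub_cancel _ _
    rw [h2]
    exact h1
  have h := duhamel (exclGen hp M K) ht
    (y := fun s => admInd M K * prodFun M (walkFun hp B s))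
    (g := fun s => source hp M K (walkFun hp B s))
    (continuous_const.mul (continuous_prodFun hp M B)).continuousOn
    (fun s _ => hd s)
    (continuous_source hp M K B).continuousOn
  have h2 := congrArg (fun f : (Fin M → ℤ) →ᵇ ℝ => f x) h
  have h3 := (BoundedContinuousFunction.evalCLM ℝ x).intervalIntegral_comp_comm
    (hc.intervalIntegrable (μ := volume) 0 t)
  rw [walkFun_zero] at h2
  refine h2.trans ?_
  rw [BoundedContinuousFunction.coe_add, Pi.add_apply]
  congr 1
  exact h3.symm

/-- Negative correlation of exclusion particles: the Duhamel correction is a positive semigroup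
applied to the nonnegative `source`. It serves both for the lower bound, with the occupied set, and
inside the upper bound, with the interval `A`. -/
theorem exclSemi_le (hp : IsJumpKernel p) (hK : 1 ≤ K) (B : Set ℝ) {t : ℝ} (ht : 0 ≤ t)
    (x : Fin M → ℤ) :
    exclSemi hp M K t (admInd M K * prodFun M (siteInd B)) x ≤
      admInd M K x * prodFun M (walkFun hp B t) x := by
  rw [admInd_mul_prodFun_eq hp M K B ht, le_add_iff_nonneg_right]
  refine intervalIntegral.integral_nonneg ht fun s hs => ?_
  exact (isPosOp_exclOp hp).semi_op _ (sub_nonneg.2 hs.2) _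
    (source_nonneg hp hK (walkFun_nonneg hp B hs.1)) x

end Exclusion

/-! ### Self-duality of the generator -/

section Duality

open scoped BoundedContinuousFunction

variable {p : ℤ → ℤ → ℝ} {M K : ℕ}

/-- The duality function `∏_u [η u]_{ξ u} / [K]_{ξ u}`. -/
noncomputable def dual (K : ℕ) (x : Fin M → ℤ) (η : ℤ → ℕ) : ℝ :=
  (facProd η x : ℝ) / exclWeight K x

theorem dual_nonneg (x : Fin M → ℤ) (η : ℤ → ℕ) : 0 ≤ dual K x η := by
  unfold dual; positivity

theorem facProd_le_exclWeight {η : ℤ → ℕ} (h : ∀ u, η u ≤ K) (x : Fin M → ℤ) :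
    facProd η x ≤ exclWeight K x := facProd_mono h x

theorem dual_le_one {η : ℤ → ℕ} (h : ∀ u, η u ≤ K) (x : Fin M → ℤ) : dual K x η ≤ 1 :=
  div_le_one_of_le₀ (by exact_mod_cast facProd_le_exclWeight h x) (by positivity)

theorem abs_dual_sub_le {η ζ : ℤ → ℕ} (h : ∀ u, η u ≤ K) (h' : ∀ u, ζ u ≤ K) {N : ℕ}
    (x : Fin M → ℤ) (y : Fin N → ℤ) : |dual K x η - dual K y ζ| ≤ 1 := by
  rw [abs_le]
  have := dual_nonneg (K := K) x η
  have := dual_nonneg (K := K) y ζ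
  have := dual_le_one h x
  have := dual_le_one h' y
  constructor <;> linarith

theorem exclWeight_mul_dual {η : ℤ → ℕ} (h : ∀ u, η u ≤ K) (x : Fin M → ℤ) :
    (exclWeight K x : ℝ) * dual K x η = facProd η x := by
  rw [dual]
  rcases eq_or_ne (exclWeight K x) 0 with h0 | h0
  · have := facProd_le_exclWeight h x
    have : facProd η x = 0 := by omega
    simp [this]
  · field_simp

theorem dependsOn_dual (x : Fin M → ℤ) :
    DependsOn (dual K x) ((Finset.univ.image x : Finset ℤ) : Set ℤ) := by
  intro η ζ h
  have : facProd η x = facProd ζ x := by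
    rw [facProd_eq_prod η x subset_rfl, facProd_eq_prod ζ x subset_rfl]
    exact Finset.prod_congr rfl fun u hu => by rw [h u hu]
  rw [dual, dual, this]

theorem cast_descFactorial_succ (n k : ℕ) :
    (n.descFactorial (k + 1) : ℝ) = (n - k) * n.descFactorial k := by
  rw [Nat.descFactorial_succ]
  rcases le_or_gt k n with h | h
  · push_cast [Nat.cast_sub h]; ring
  · simp [Nat.descFactorial_of_lt h]

theorem mul_descFactorial_pred (n k : ℕ) :
    (n : ℝ) * (n - 1).descFactorial k = (n - k) * n.descFactorial k := by
  rw [← cast_descFactorial_succ]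
  cases n with
  | zero => simp
  | succ n => rw [Nat.succ_descFactorial_succ]; simp

theorem descFactorial_succ_left (n k : ℕ) :
    ((n + 1).descFactorial k : ℝ) = n.descFactorial k + k * n.descFactorial (k - 1) := by
  cases k with
  | zero => simp
  | succ k =>
    rw [Nat.succ_descFactorial_succ, cast_descFactorial_succ]
    push_cast
    ring

theorem mul_descFactorial_eq (n k : ℕ) :
    (k : ℝ) * n.descFactorial k = k * n.descFactorial (k - 1) * (n - k + 1) := by
  cases k with
  | zero => simp
  | succ k =>
    rw [cast_descFactorial_succ, Nat.add_sub_cancel]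
    push_cast
    ring

/-- The duality relation for a single bond. -/
theorem bond_duality (K : ℝ) (α β k l : ℕ) :
    α * (K - β) * ((α - 1).descFactorial k * (β + 1).descFactorial l -
        α.descFactorial k * β.descFactorial l) +
      β * (K - α) * ((α + 1).descFactorial k * (β - 1).descFactorial l -
        α.descFactorial k * β.descFactorial l) =
    k * ((K - k + 1) * (α.descFactorial (k - 1) * β.descFactorial (l + 1)) -
        (K - l) * (α.descFactorial k * β.descFactorial l)) +
      l * ((K - l + 1) * (α.descFactorial (k + 1) * β.descFactorial (l - 1)) -
        (K - k) * (α.descFactorial k * β.descFactorial l)) := by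
  have e1 := mul_descFactorial_pred α k
  have e2 := mul_descFactorial_pred β l
  have e3 := mul_descFactorial_eq α k
  have e4 := mul_descFactorial_eq β l
  rw [descFactorial_succ_left α, descFactorial_succ_left β, cast_descFactorial_succ α,
    cast_descFactorial_succ β]
  -- After the recurrences, `e1` to `e4` are the only relations needed between the falling
  -- factorials, which can be treated as free variables.
  generalize (α.descFactorial k : ℝ) = a at *
  generalize (β.descFactorial l : ℝ) = b at *
  generalize (α.descFactorial (k - 1) : ℝ) = a' at *
  generalize (β.descFactorial (l - 1) : ℝ) = b' at *
  linear_combination (K - β) * (b + l * b') * e1 + (K - α) * (a + k * a') * e2 +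
    (β - l) * b * e3 + (α - k) * a * e4

theorem facProd_split (η : ℤ → ℕ) (x : Fin M → ℤ) {a b : ℤ} (hab : a ≠ b) (U : Finset ℤ)
    (hU : Finset.univ.image x ⊆ insert a (insert b U)) :
    facProd η x = (η a).descFactorial (occ x a) * ((η b).descFactorial (occ x b) *
      ∏ u ∈ (U.erase a).erase b, (η u).descFactorial (occ x u)) := by
  have hU' : Finset.univ.image x ⊆ insert a (insert b ((U.erase a).erase b)) := by
    intro u hu
    have := hU hu
    simp only [Finset.mem_insert, Finset.mem_erase] at this ⊢
    tauto
  rw [facProd_eq_prod η x hU', Finset.prod_insert (by simp [hab]),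
    Finset.prod_insert (by simp)]

/-- The rate of change of `dual K x` by jumps over the oriented bond `(a, b)`. -/
noncomputable def bondGen (K : ℕ) (x : Fin M → ℤ) (η : ℤ → ℕ) (a b : ℤ) : ℝ :=
  (η a : ℝ) * ((K : ℝ) - η b) * (dual K x (moveParticle η a b) - dual K x η)

/-- The rate of change of `dual K · η` by jumps over the oriented bond `(a, b)`. -/
noncomputable def bondDual (K : ℕ) (x : Fin M → ℤ) (η : ℤ → ℕ) (a b : ℤ) : ℝ :=
  ∑ i, if a = x i then K * (acceptProb K x b * (dual K (Function.update x i b) η - dual K x η))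
    else 0

/-- All coordinates sitting at `a` contribute equally, whence the factor `occ x a`. Multiplying by
the weight and using detailed balance clears the denominators, leaving one half of the right side of
`bond_duality` times the factors away from the bond. -/
theorem bondDual_eq (hK : 1 ≤ K) (x : Fin M → ℤ) (hx : exclWeight K x ≠ 0) {η : ℤ → ℕ}
    (hη : ∀ u, η u ≤ K) {a b : ℤ} (hab : a ≠ b) (U : Finset ℤ)
    (hU : Finset.univ.image x ⊆ insert a (insert b U)) :
    (exclWeight K x : ℝ) * bondDual K x η a b =
      occ x a * (((K : ℝ) - occ x a + 1) * ((η a).descFactorial (occ x a - 1) *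
          (η b).descFactorial (occ x b + 1)) -
        (K - occ x b) * ((η a).descFactorial (occ x a) * (η b).descFactorial (occ x b))) *
      ∏ u ∈ (U.erase a).erase b, ((η u).descFactorial (occ x u) : ℝ) := by
  have hocc : ∀ u, occ x u ≤ K := (facProd_ne_zero_iff _ x).1 hx
  have hKr : (K : ℝ) ≠ 0 := by positivity
  rw [bondDual, Finset.mul_sum]
  have key : ∀ i, (exclWeight K x : ℝ) * (if a = x i then
      K * (acceptProb K x b * (dual K (Function.update x i b) η - dual K x η)) else 0) =
      (if x i = a then (1 : ℝ) else 0) * ((((K : ℝ) - occ x a + 1) *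
        ((η a).descFactorial (occ x a - 1) * (η b).descFactorial (occ x b + 1)) -
        (K - occ x b) * ((η a).descFactorial (occ x a) * (η b).descFactorial (occ x b))) *
      ∏ u ∈ (U.erase a).erase b, ((η u).descFactorial (occ x u) : ℝ)) := by
    intro i
    by_cases hi : a = x i
    · subst hi
      rw [if_pos rfl, if_pos rfl, one_mul]
      have h1 : (exclWeight K x : ℝ) * acceptProb K x b * dual K (Function.update x i b) η =
          ((K : ℝ) - occ x (x i) + 1) / K * facProd η (Function.update x i b) := by
        rw [exclWeight_mul_acceptProb x i hab.symm, mul_right_comm,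
          exclWeight_mul_dual hη]
        rcases eq_or_ne (exclWeight K (Function.update x i b)) 0 with h0 | h0
        · have := facProd_le_exclWeight hη (Function.update x i b)
          have : facProd η (Function.update x i b) = 0 := by omega
          simp [this]
        · have h2 := occ_update_old x i b hab.symm
          have h3 : ((K - occ (Function.update x i b) (x i) : ℕ) : ℝ) =
              (K : ℝ) - occ x (x i) + 1 := by
            rw [Nat.cast_sub (by have := hocc (x i); omega), ← h2]
            push_cast; ring
          rw [acceptProb, if_neg h0, h3]
          ring
      have h2 : (exclWeight K x : ℝ) * acceptProb K x b * dual K x η =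
          ((K : ℝ) - occ x b) / K * facProd η x := by
        rw [mul_right_comm, exclWeight_mul_dual hη, acceptProb, if_neg hx,
          Nat.cast_sub (hocc b)]
        ring
      have h3 : facProd η (Function.update x i b) =
          (η (x i)).descFactorial (occ x (x i) - 1) * ((η b).descFactorial (occ x b + 1) *
            ∏ u ∈ (U.erase (x i)).erase b, (η u).descFactorial (occ x u)) := by
        have hU' : Finset.univ.image (Function.update x i b) ⊆ insert (x i) (insert b U) := by
          intro u hu
          obtain ⟨j, -, rfl⟩ := Finset.mem_image.1 hu
          rcases eq_or_ne j i with rfl | hj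
          · simp
          · rw [Function.update_of_ne hj]
            exact hU (Finset.mem_image_of_mem _ (Finset.mem_univ j))
        rw [facProd_split η _ hab U hU', occ_update_self x i b hab.symm,
          ← occ_update_old x i b hab.symm, Nat.add_sub_cancel]
        congr 2
        refine Finset.prod_congr rfl fun u hu => ?_
        rw [occ_update_of_ne x i b u (Finset.ne_of_mem_erase hu)
          (Finset.ne_of_mem_erase (Finset.mem_of_mem_erase hu))]
      have h4 := facProd_split η x hab U hU
      calc _ = K * ((exclWeight K x : ℝ) * acceptProb K x b * dual K (Function.update x i b) η) -
            K * ((exclWeight K x : ℝ) * acceptProb K x b * dual K x η) := by ring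
        _ = _ := by
          rw [h1, h2, h3, h4]
          push_cast
          field_simp
    · rw [if_neg hi, if_neg (Ne.symm hi)]
      simp
  rw [Finset.sum_congr rfl fun i _ => key i, ← Finset.sum_mul, ← occ_eq_sum]
  ring

theorem bondGen_eq (x : Fin M → ℤ) (hx : exclWeight K x ≠ 0) {η : ℤ → ℕ}
    {a b : ℤ} (hab : a ≠ b) (U : Finset ℤ)
    (hU : Finset.univ.image x ⊆ insert a (insert b U)) :
    (exclWeight K x : ℝ) * bondGen K x η a b =
      η a * ((K : ℝ) - η b) * ((η a - 1).descFactorial (occ x a) *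
          (η b + 1).descFactorial (occ x b) -
        (η a).descFactorial (occ x a) * (η b).descFactorial (occ x b)) *
      ∏ u ∈ (U.erase a).erase b, ((η u).descFactorial (occ x u) : ℝ) := by
  have hx' : (exclWeight K x : ℝ) ≠ 0 := by exact_mod_cast hx
  have h1 := facProd_split η x hab U hU
  have h2 : facProd (moveParticle η a b) x = (η a - 1).descFactorial (occ x a) *
      ((η b + 1).descFactorial (occ x b) *
        ∏ u ∈ (U.erase a).erase b, (η u).descFactorial (occ x u)) := by
    rw [facProd_split _ x hab U hU]
    congr 2
    · simp [moveParticle]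
    · simp [moveParticle, hab.symm]
    · refine Finset.prod_congr rfl fun u hu => ?_
      have hb := Finset.ne_of_mem_erase hu
      have ha := Finset.ne_of_mem_erase (Finset.mem_of_mem_erase hu)
      simp [moveParticle, ha, hb]
  rw [bondGen, dual, dual, h1, h2]
  push_cast
  field_simp

/-- Duality is obtained for the two orientations of a bond together; symmetry of `p` makes this
enough. -/
theorem bond_symm (hK : 1 ≤ K) (x : Fin M → ℤ) (hx : exclWeight K x ≠ 0) {η : ℤ → ℕ}
    (hη : ∀ u, η u ≤ K) {a b : ℤ} (hab : a ≠ b) :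
    bondGen K x η a b + bondGen K x η b a = bondDual K x η a b + bondDual K x η b a := by
  have hx' : (exclWeight K x : ℝ) ≠ 0 := by exact_mod_cast hx
  have hU : Finset.univ.image x ⊆ insert a (insert b (Finset.univ.image x)) := fun u hu => by
    simp only [Finset.mem_insert]; tauto
  have hU' : Finset.univ.image x ⊆ insert b (insert a (Finset.univ.image x)) := fun u hu => by
    simp only [Finset.mem_insert]; tauto
  apply mul_left_cancel₀ hx'
  rw [mul_add, mul_add, bondGen_eq x hx hab _ hU, bondGen_eq x hx hab.symm _ hU',
    bondDual_eq hK x hx hη hab _ hU, bondDual_eq hK x hx hη hab.symm _ hU',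
    Finset.erase_right_comm (a := b)]
  have := bond_duality K (η a) (η b) (occ x a) (occ x b)
  linear_combination (∏ u ∈ ((Finset.univ.image x).erase a).erase b,
    ((η u).descFactorial (occ x u) : ℝ)) * this

theorem hasSum_row (hp : IsJumpKernel p) {c : ℤ → ℝ} {C : ℝ} (hc : ∀ b, |c b| ≤ C) (a : ℤ) :
    HasSum (fun q : ℤ × ℤ => p q.1 q.2 * if q.1 = a then c q.2 else 0) (∑' b, p a b * c b) := by
  have h : HasSum (fun b => p a b * c b) (∑' b, p a b * c b) :=
    ((walkJump hp).summable_mul a hc).hasSum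
  have hinj : Function.Injective fun b : ℤ => (a, b) := fun b c h => (Prod.ext_iff.1 h).2
  rw [← hinj.hasSum_iff]
  · convert h using 2 with b
    simp
  · rintro ⟨a', b⟩ hq
    have : a' ≠ a := fun h => hq ⟨b, by rw [h]⟩
    simp [this]

theorem hasSum_bondDual (hp : IsJumpKernel p) (x : Fin M → ℤ) {η : ℤ → ℕ}
    (hη : ∀ u, η u ≤ K) :
    HasSum (fun q : ℤ × ℤ => p q.1 q.2 * bondDual K x η q.1 q.2)
      (K * ∑ i, ∑' y, p (x i) y *
        (acceptProb K x y * (dual K (Function.update x i y) η - dual K x η))) := by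
  have hb : ∀ i y, |K * (acceptProb K x y *
      (dual K (Function.update x i y) η - dual K x η))| ≤ K := by
    intro i y
    rw [abs_mul, abs_mul, abs_of_nonneg (acceptProb_nonneg x y), Nat.abs_cast]
    refine mul_le_of_le_one_right (by positivity) ?_
    exact mul_le_one₀ (acceptProb_le_one x y) (abs_nonneg _) (abs_dual_sub_le hη hη _ _)
  have h := hasSum_sum fun i (_ : i ∈ Finset.univ) => hasSum_row hp (hb i) (x i)
  convert h using 1
  · funext q
    rw [bondDual, Finset.mul_sum]
  · rw [Finset.mul_sum]
    refine Finset.sum_congr rfl fun i _ => ?_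
    rw [← tsum_mul_left]
    exact tsum_congr fun y => by ring

/-- A bond away from the sites of `x` does not change the duality function, and any other term is at
most `K * K` times `p`. Finitely many rows and columns of `p` dominate the sum. -/
theorem summable_bondGen (hp : IsJumpKernel p) (x : Fin M → ℤ) {η : ℤ → ℕ}
    (hη : ∀ u, η u ≤ K) :
    Summable fun q : ℤ × ℤ => p q.1 q.2 * bondGen K x η q.1 q.2 := by
  have hrow : Summable fun q : ℤ × ℤ => ∑ i,
      p q.1 q.2 * if q.1 = x i then ((K : ℝ) * K) else 0 :=
    summable_sum fun i _ => (hasSum_row hp (c := fun _ => (K : ℝ) * K) (fun _ => le_rfl)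
      (x i)).summable
  have hcol : Summable fun q : ℤ × ℤ => ∑ i,
      p q.1 q.2 * if q.2 = x i then ((K : ℝ) * K) else 0 := by
    have := (Equiv.prodComm ℤ ℤ).summable_iff.2 hrow
    refine this.congr fun q => ?_
    exact Finset.sum_congr rfl fun i _ => by
      change p q.2 q.1 * _ = _
      rw [hp.symm]; rfl
  refine Summable.of_norm_bounded (hrow.add hcol) fun q => ?_
  have hbound : |bondGen K x η q.1 q.2| ≤ (K : ℝ) * K := by
    rw [bondGen, abs_mul]
    rcases (hη q.2).eq_or_lt with h | h
    -- At a full target site the rate is `0`. This case is separate because `moveParticle` would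
    -- leave the configurations bounded by `K`.
    · rw [h]; simp; positivity
    · have hm : ∀ u, moveParticle η q.1 q.2 u ≤ K := by
        intro u
        unfold moveParticle
        split_ifs
        · exact (Nat.sub_le _ _).trans (hη _)
        · exact h
        · exact hη u
      have h1 : (η q.1 : ℝ) ≤ K := by exact_mod_cast hη q.1
      have h2 : (η q.2 : ℝ) ≤ K := by exact_mod_cast hη q.2
      have h3 : (0 : ℝ) ≤ η q.2 := by positivity
      have h4 : |(η q.1 : ℝ) * (K - η q.2)| ≤ K * K := by
        rw [abs_of_nonneg (mul_nonneg (by positivity) (by linarith))]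
        exact mul_le_mul h1 (by linarith) (by linarith) (by positivity)
      calc _ ≤ (K : ℝ) * K * 1 := mul_le_mul h4 (abs_dual_sub_le hm hη x x) (abs_nonneg _)
            (by positivity)
        _ = _ := mul_one _
  have hterm : ∀ (u : ℤ) (i : Fin M), 0 ≤ p q.1 q.2 * if u = x i then ((K : ℝ) * K) else 0 :=
    fun u i => mul_nonneg (hp.nonneg _ _) (by split_ifs <;> positivity)
  rw [Real.norm_eq_abs, abs_mul, abs_of_nonneg (hp.nonneg _ _)]
  by_cases h1 : ∃ i, q.1 = x i
  · obtain ⟨i, hi⟩ := h1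
    have := Finset.single_le_sum (fun i _ => hterm q.1 i) (Finset.mem_univ i)
    simp only [if_pos hi] at this
    exact (mul_le_mul_of_nonneg_left hbound (hp.nonneg _ _)).trans
      (this.trans (le_add_of_nonneg_right (Finset.sum_nonneg fun j _ => hterm q.2 j)))
  by_cases h2 : ∃ i, q.2 = x i
  · obtain ⟨i, hi⟩ := h2
    have := Finset.single_le_sum (fun i _ => hterm q.2 i) (Finset.mem_univ i)
    simp only [if_pos hi] at this
    exact (mul_le_mul_of_nonneg_left hbound (hp.nonneg _ _)).trans
      (this.trans (le_add_of_nonneg_left (Finset.sum_nonneg fun j _ => hterm q.1 j)))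
  have h0 : bondGen K x η q.1 q.2 = 0 := by
    have : dual K x (moveParticle η q.1 q.2) = dual K x η := by
      refine dependsOn_dual x fun u hu => ?_
      obtain ⟨i, -, rfl⟩ := Finset.mem_image.1 (Finset.mem_coe.1 hu)
      push Not at h1 h2
      simp [moveParticle, (h1 i).symm, (h2 i).symm]
    rw [bondGen, this, sub_self, mul_zero]
  rw [h0, abs_zero, mul_zero]
  exact add_nonneg (Finset.sum_nonneg fun j _ => hterm q.1 j)
    (Finset.sum_nonneg fun j _ => hterm q.2 j)

/-- Self-duality of the `K`-particle-per-site exclusion process, on the level of generators. -/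
theorem ksepGenerator_dual (hp : IsJumpKernel p) (hK : 1 ≤ K) (x : Fin M → ℤ) {η : ℤ → ℕ}
    (hη : ∀ u, η u ≤ K) :
    ksepGenerator p K (dual K x) η = K * ∑ i, ∑' y, p (x i) y *
        (acceptProb K x y * (dual K (Function.update x i y) η - dual K x η)) := by
  have h1 : ksepGenerator p K (dual K x) η =
      ∑' q : ℤ × ℤ, p q.1 q.2 * bondGen K x η q.1 q.2 :=
    tsum_congr fun q => by rw [bondGen]; ring
  rw [h1, ← (hasSum_bondDual hp x hη).tsum_eq]
  rcases eq_or_ne (exclWeight K x) 0 with h0 | h0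
  · refine tsum_congr fun q => ?_
    simp [bondGen, bondDual, dual, acceptProb, h0]
  have s1 := (summable_bondGen hp x hη)
  have s2 := (hasSum_bondDual hp x hη).summable
  -- Averaging over the two orientations of each bond reduces the equality of sums to `bond_symm`.
  have swap : ∀ f : ℤ × ℤ → ℝ, Summable f →
      2 * ∑' q, f q = ∑' q : ℤ × ℤ, (f q + f q.swap) := by
    intro f hf
    have hf' : Summable fun q : ℤ × ℤ => f q.swap := (Equiv.prodComm ℤ ℤ).summable_iff.2 hf
    rw [hf.tsum_add hf', two_mul]
    congr 1
    exact ((Equiv.prodComm ℤ ℤ).tsum_eq f).symm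
  have h2 : (2 : ℝ) ≠ 0 := two_ne_zero
  apply mul_left_cancel₀ h2
  rw [swap _ s1, swap _ s2]
  refine tsum_congr fun q => ?_
  obtain ⟨a, b⟩ := q
  simp only [Prod.swap]
  rcases eq_or_ne a b with rfl | hab
  · rw [hp.diag]; ring
  · rw [hp.symm b a, ← mul_add, ← mul_add, bond_symm hK x h0 hη hab]

end Duality

/-! ### From the martingale problem to the duality formula -/

section MartingaleProblem

open scoped BoundedContinuousFunction

/-- The integral equation is only known pointwise in `x`. Boundedness of `G` and of `u` makes `u`
Lipschitz in the supremum norm, so the equation holds in norm, `u` is differentiable, and `duhamel`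
without forcing identifies it. -/
theorem eq_flow_of_integral_eq {E : Type*} [TopologicalSpace E]
    (G : (E →ᵇ ℝ) →L[ℝ] (E →ᵇ ℝ)) (u : ℝ → E →ᵇ ℝ) {C : ℝ} (hC : ∀ s, ‖u s‖ ≤ C)
    (hmax : ∀ s, u s = u (max s 0))
    (hint : ∀ x, ∀ t, IntervalIntegrable (fun r => G (u r) x) volume 0 t)
    (hu : ∀ x, ∀ t, 0 ≤ t → u t x = u 0 x + ∫ r in (0 : ℝ)..t, G (u r) x) {t : ℝ} (ht : 0 ≤ t) :
    u t = flow G t (u 0) := by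
  have hC0 : 0 ≤ C := (norm_nonneg _).trans (hC 0)
  have hlip : ∀ s t, 0 ≤ s → 0 ≤ t → ‖u t - u s‖ ≤ ‖G‖ * C * |t - s| := by
    intro s t hs ht
    refine (BoundedContinuousFunction.norm_le (by positivity)).2 fun x => ?_
    have h1 : (u t - u s) x = ∫ r in s..t, G (u r) x := by
      rw [BoundedContinuousFunction.coe_sub, Pi.sub_apply, hu x t ht, hu x s hs,
        ← intervalIntegral.integral_interval_sub_left (hint x t) (hint x s)]
      ring
    rw [h1]
    refine intervalIntegral.norm_integral_le_of_norm_le_const fun r _ => ?_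
    calc ‖G (u r) x‖ ≤ ‖G (u r)‖ := (G (u r)).norm_coe_le_norm x
      _ ≤ ‖G‖ * ‖u r‖ := G.le_opNorm _
      _ ≤ ‖G‖ * C := by gcongr; exact hC r
  have hcont : Continuous u := by
    have hl : LipschitzWith (Real.toNNReal (‖G‖ * C)) u := by
      refine LipschitzWith.of_dist_le_mul fun s t => ?_
      rw [dist_eq_norm, hmax s, hmax t, Real.coe_toNNReal _ (by positivity), Real.dist_eq]
      refine (hlip _ _ (le_max_right _ _) (le_max_right _ _)).trans ?_
      exact mul_le_mul_of_nonneg_left (abs_max_sub_max_le_abs s t 0) (by positivity)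
    exact hl.continuous
  have hGu : Continuous fun r => G (u r) := G.continuous.comp hcont
  have heq : ∀ s, 0 ≤ s → u s = u 0 + ∫ r in (0 : ℝ)..s, G (u r) := by
    intro s hs
    ext x
    have h3 := (BoundedContinuousFunction.evalCLM ℝ x).intervalIntegral_comp_comm
      (hGu.intervalIntegrable (μ := volume) 0 s)
    rw [hu x s hs, BoundedContinuousFunction.coe_add, Pi.add_apply]
    congr 1
  have hd : ∀ s ∈ Ioo 0 t, HasDerivAt u (G (u s) + 0) s := by
    intro s hs
    have h1 : HasDerivAt (fun s => u 0 + ∫ r in (0 : ℝ)..s, G (u r)) (G (u s)) s :=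
      (hGu.integral_hasStrictDerivAt 0 s).hasDerivAt.const_add _
    rw [add_zero]
    refine h1.congr_of_eventuallyEq ?_
    filter_upwards [lt_mem_nhds hs.1] with r hr
    exact heq r hr.le
  have h := duhamel G ht (g := fun _ => 0) hcont.continuousOn hd continuousOn_const
  simpa using h

variable {p : ℤ → ℤ → ℝ} {M K : ℕ} {Ω : Type*} [MeasurableSpace Ω] {P : Measure Ω}
  {η : ℤ → ℕ} {X : ℝ≥0 → Ω → ℤ → ℕ}

theorem IsKSEP.measurable (hX : IsKSEP p K P η X) (t : ℝ≥0) : Measurable (X t) := by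
  obtain ⟨ℱ, h, -⟩ := hX.martingale_problem
  exact (h t).mono (ℱ.le t) le_rfl

/-- Times are approximated from the right by grid points `d n s`. The discretised processes take
countably many times, hence are jointly measurable, and converge by right continuity. -/
theorem measurable_uncurry_of_rightCont (hm : ∀ t, Measurable (X t))
    (hr : ∀ ω t, ContinuousWithinAt (fun s => X s ω) (Ici t) t) :
    Measurable fun q : ℝ≥0 × Ω => X q.1 q.2 := by
  let d : ℕ → ℝ≥0 → ℝ≥0 := fun n s => ((⌊s * (n + 1)⌋₊ : ℝ≥0) + 1) / (n + 1)
  have hd1 : ∀ n s, s ≤ d n s := by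
    intro n s
    rw [le_div_iff₀ (by positivity)]
    exact (Nat.lt_floor_add_one _).le
  have hd2 : ∀ n s, d n s ≤ s + 1 / (n + 1) := by
    intro n s
    rw [div_le_iff₀ (by positivity), add_mul, one_div, inv_mul_cancel₀ (by positivity)]
    gcongr
    exact Nat.floor_le zero_le
  have hd : ∀ s, Tendsto (fun n => d n s) atTop (𝓝[Ici s] s) := by
    intro s
    refine tendsto_nhdsWithin_iff.2 ⟨?_, Eventually.of_forall fun n => hd1 n s⟩
    refine tendsto_of_tendsto_of_tendsto_of_le_of_le tendsto_const_nhds ?_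
      (fun n => hd1 n s) (fun n => hd2 n s)
    have := (tendsto_one_div_add_atTop_nhds_zero_nat (𝕜 := ℝ≥0)).const_add s
    simpa using this
  refine measurable_of_tendsto_metrizable (f := fun n (q : ℝ≥0 × Ω) => X (d n q.1) q.2) ?_ ?_
  · intro n
    have h1 : Measurable fun q : ℕ × Ω => X (((q.1 : ℝ≥0) + 1) / (n + 1)) q.2 :=
      measurable_from_prod_countable_right fun k => hm (((k : ℝ≥0) + 1) / (n + 1))
    have h2 : Measurable fun q : ℝ≥0 × Ω => ((⌊q.1 * (n + 1)⌋₊ : ℕ), q.2) :=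
      ((Nat.measurable_floor.comp (measurable_fst.mul_const _))).prodMk measurable_snd
    have h3 := Measurable.comp (g := fun q : ℕ × Ω => X (((q.1 : ℝ≥0) + 1) / (n + 1)) q.2) h1 h2
    simp only [Function.comp_def] at h3
    exact h3
  · rw [tendsto_pi_nhds]
    intro q
    exact (hr q.2 q.1).tendsto.comp (hd q.1)

theorem measurable_facProd (x : Fin M → ℤ) : Measurable fun η : ℤ → ℕ => facProd η x := by
  simp_rw [facProd_eq_prod _ x subset_rfl]
  refine Finset.measurable_fun_prod _ fun u _ => ?_
  exact (measurable_from_nat (f := fun k => k.descFactorial (occ x u))).comp (measurable_pi_apply u)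

theorem measurable_dual (x : Fin M → ℤ) : Measurable (dual K x) := by
  unfold dual
  exact ((measurable_from_nat (f := fun k : ℕ => (k : ℝ))).comp (measurable_facProd x)).div_const _

variable [IsProbabilityMeasure P]

theorem IsKSEP.integrable_dual (hX : IsKSEP p K P η X) (x : Fin M → ℤ) (t : ℝ≥0) :
    Integrable (fun ω => dual K x (X t ω)) P := by
  refine Integrable.of_bound ((measurable_dual x).comp (hX.measurable t)).aestronglyMeasurable 1
    (Eventually.of_forall fun ω => ?_)
  rw [Real.norm_eq_abs, abs_of_nonneg (dual_nonneg _ _)]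
  exact dual_le_one (fun u => hX.le_K t ω u) x

/-- The expectation of the duality function at time `t`. -/
noncomputable def dualMean (K : ℕ) (P : Measure Ω) [IsProbabilityMeasure P] (X : ℝ≥0 → Ω → ℤ → ℕ)
    (hX : ∀ t ω x, X t ω x ≤ K) (M : ℕ) (t : ℝ) : (Fin M → ℤ) →ᵇ ℝ :=
  BoundedContinuousFunction.ofNormedAddCommGroupDiscrete (β := ℝ)
    (fun x => ∫ ω, dual K x (X t.toNNReal ω) ∂P) 1 fun x => by
      have h := norm_integral_le_of_norm_le_const (μ := P) (C := 1)
        (f := fun ω => dual K x (X t.toNNReal ω)) (Eventually.of_forall fun ω => by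
          rw [Real.norm_eq_abs, abs_of_nonneg (dual_nonneg _ _)]
          exact dual_le_one (fun u => hX _ ω u) x)
      simpa using h

theorem dualMean_apply (hX : ∀ t ω x, X t ω x ≤ K) (t : ℝ) (x : Fin M → ℤ) :
    dualMean K P X hX M t x = ∫ ω, dual K x (X t.toNNReal ω) ∂P := rfl

theorem norm_dualMean_le (hX : ∀ t ω x, X t ω x ≤ K) (t : ℝ) :
    ‖dualMean K P X hX M t‖ ≤ 1 := by
  refine (BoundedContinuousFunction.norm_le zero_le_one).2 fun x => ?_
  have h := norm_integral_le_of_norm_le_const (μ := P) (C := 1)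
    (f := fun ω => dual K x (X t.toNNReal ω)) (Eventually.of_forall fun ω => by
      rw [Real.norm_eq_abs, abs_of_nonneg (dual_nonneg _ _)]
      exact dual_le_one (fun u => hX _ ω u) x)
  rw [dualMean_apply]
  simpa using h

/-- Duality turns the expected generator into an operator acting on the tuple variable of the means
themselves, so the moment equations of order `M` close. -/
theorem IsKSEP.integral_ksepGenerator (hp : IsJumpKernel p) (hK : 1 ≤ K)
    (hX : IsKSEP p K P η X) (t : ℝ) (x : Fin M → ℤ) :
    ∫ ω, ksepGenerator p K (dual K x) (X t.toNNReal ω) ∂P =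
      ((K : ℝ) • exclGen hp M K) (dualMean K P X hX.le_K M t) x := by
  have h1 : ∀ ω, ksepGenerator p K (dual K x) (X t.toNNReal ω) = _ := fun ω =>
    ksepGenerator_dual hp hK x (hX.le_K t.toNNReal ω)
  simp_rw [h1]
  rw [integral_const_mul]
  change _ = (K : ℝ) * exclGen hp M K (dualMean K P X hX.le_K M t) x
  rw [exclGen_apply]
  congr 1
  have hi : ∀ i y, Integrable (fun ω => p (x i) y * (acceptProb K x y *
      (dual K (Function.update x i y) (X t.toNNReal ω) - dual K x (X t.toNNReal ω)))) P :=
    fun i y => (((hX.integrable_dual _ _).sub (hX.integrable_dual _ _)).const_mul _).const_mul _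
  have hb : ∀ i y, ∀ ω, ‖p (x i) y * (acceptProb K x y *
      (dual K (Function.update x i y) (X t.toNNReal ω) - dual K x (X t.toNNReal ω)))‖ ≤
      p (x i) y := by
    intro i y ω
    rw [Real.norm_eq_abs, abs_mul, abs_mul, abs_of_nonneg (hp.nonneg _ _),
      abs_of_nonneg (acceptProb_nonneg x y)]
    refine mul_le_of_le_one_right (hp.nonneg _ _) ?_
    exact mul_le_one₀ (acceptProb_le_one x y) (abs_nonneg _)
      (abs_dual_sub_le (hX.le_K _ ω) (hX.le_K _ ω) _ _)
  have hs : ∀ i, Summable fun y => ∫ ω, ‖p (x i) y * (acceptProb K x y *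
      (dual K (Function.update x i y) (X t.toNNReal ω) - dual K x (X t.toNNReal ω)))‖ ∂P := by
    intro i
    refine Summable.of_nonneg_of_le (fun y => integral_nonneg fun ω => norm_nonneg _) (fun y => ?_)
      (hp.hasSum_one (x i)).summable
    calc _ ≤ ∫ _ω, p (x i) y ∂P := integral_mono (hi i y).norm (integrable_const _) (hb i y)
      _ = _ := by simp
  rw [integral_finsetSum]
  · refine Finset.sum_congr rfl fun i _ => ?_
    rw [← integral_tsum_of_summable_integral_norm (hi i) (hs i)]
    refine tsum_congr fun y => ?_
    rw [integral_const_mul, integral_const_mul,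
      integral_sub (hX.integrable_dual _ _) (hX.integrable_dual _ _)]
    rfl
  · intro i _
    refine Integrable.of_bound ?_ 1 (Eventually.of_forall fun ω => ?_)
    · refine (Measurable.tsum fun y => ?_).aestronglyMeasurable
      exact ((((measurable_dual _).comp (hX.measurable _)).sub
        ((measurable_dual _).comp (hX.measurable _))).const_mul _).const_mul _
    · exact tsum_of_norm_bounded (hp.hasSum_one (x i)) fun y => hb i y ω

theorem IsKSEP.integrable_uncurry (hp : IsJumpKernel p) (hK : 1 ≤ K)
    (hX : IsKSEP p K P η X) (t : ℝ) (x : Fin M → ℤ) :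
    Integrable (Function.uncurry fun (s : ℝ) ω =>
      ksepGenerator p K (dual K x) (X s.toNNReal ω)) ((volume.restrict (uIoc 0 t)).prod P) := by
  have hjoint : Measurable fun q : ℝ × Ω => X q.1.toNNReal q.2 :=
    (measurable_uncurry_of_rightCont hX.measurable hX.right_cont).comp
      (measurable_real_toNNReal.comp measurable_fst |>.prodMk measurable_snd)
  have hfun : (Function.uncurry fun (s : ℝ) ω =>
      ksepGenerator p K (dual K x) (X s.toNNReal ω)) = fun q : ℝ × Ω =>
      K * ∑ i, ∑' y, p (x i) y * (acceptProb K x y *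
        (dual K (Function.update x i y) (X q.1.toNNReal q.2) -
          dual K x (X q.1.toNNReal q.2))) := by
    funext q
    exact ksepGenerator_dual hp hK x (hX.le_K _ _)
  have : IsFiniteMeasure (volume.restrict (uIoc 0 t)) := by
    constructor
    rw [Measure.restrict_apply_univ, uIoc]
    exact measure_Ioc_lt_top
  rw [hfun]
  refine Integrable.of_bound ?_ (K * ∑ _i : Fin M, 1) (Eventually.of_forall fun q => ?_)
  · refine Measurable.aestronglyMeasurable (Measurable.const_mul ?_ _)
    refine Finset.measurable_fun_sum _ fun i _ => Measurable.tsum fun y => ?_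
    exact ((((measurable_dual _).comp hjoint).sub
      ((measurable_dual _).comp hjoint)).const_mul _).const_mul _
  · rw [norm_mul, Real.norm_natCast]
    gcongr
    refine (norm_sum_le _ _).trans (Finset.sum_le_sum fun i _ => ?_)
    refine tsum_of_norm_bounded (hp.hasSum_one (x i)) fun y => ?_
    rw [Real.norm_eq_abs, abs_mul, abs_mul, abs_of_nonneg (hp.nonneg _ _),
      abs_of_nonneg (acceptProb_nonneg x y)]
    refine mul_le_of_le_one_right (hp.nonneg _ _) ?_
    exact mul_le_one₀ (acceptProb_le_one x y) (abs_nonneg _)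
      (abs_dual_sub_le (hX.le_K _ _) (hX.le_K _ _) _ _)

/-- The martingale vanishes at time `0`, so its mean is zero at time `t`; Fubini exchanges
expectation and time integral. -/
theorem IsKSEP.dualMean_integral_eq (hp : IsJumpKernel p) (hK : 1 ≤ K)
    (hX : IsKSEP p K P η X) (x : Fin M → ℤ) {t : ℝ} (ht : 0 ≤ t) :
    dualMean K P X hX.le_K M t x = dualMean K P X hX.le_K M 0 x +
      ∫ r in (0 : ℝ)..t, ((K : ℝ) • exclGen hp M K) (dualMean K P X hX.le_K M r) x := by
  obtain ⟨ℱ, -, h⟩ := hX.martingale_problem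
  have hmart := h _ (dual K x) (dependsOn_dual x)
  have h1 := hmart.setIntegral_eq (zero_le (a := t.toNNReal)) MeasurableSet.univ
  simp only [setIntegral_univ, NNReal.coe_zero, intervalIntegral.integral_same, sub_self,
    integral_zero, Real.coe_toNNReal t ht] at h1
  have hI := hX.integrable_uncurry hp hK t x
  have hI2 : Integrable (fun ω => ∫ s in (0 : ℝ)..t,
      ksepGenerator p K (dual K x) (X s.toNNReal ω)) P := by
    have := hI.integral_prod_right
    rw [uIoc_of_le ht] at this
    simp_rw [intervalIntegral.integral_of_le ht]
    exact this
  have hI3 : Integrable (fun ω => dual K x (X t.toNNReal ω) - dual K x (X 0 ω)) P :=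
    (hX.integrable_dual x _).sub (hX.integrable_dual x _)
  rw [integral_sub hI3 hI2, integral_sub (hX.integrable_dual x _) (hX.integrable_dual x _),
    ← intervalIntegral_integral_swap hI] at h1
  simp_rw [← hX.integral_ksepGenerator hp hK]
  rw [dualMean_apply, dualMean_apply, Real.toNNReal_zero]
  linarith

theorem IsKSEP.intervalIntegrable (hp : IsJumpKernel p) (hK : 1 ≤ K)
    (hX : IsKSEP p K P η X) (x : Fin M → ℤ) (t : ℝ) :
    IntervalIntegrable (fun r => ((K : ℝ) • exclGen hp M K) (dualMean K P X hX.le_K M r) x)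
      volume 0 t := by
  simp_rw [← hX.integral_ksepGenerator hp hK]
  rw [intervalIntegrable_iff]
  exact (hX.integrable_uncurry hp hK t x).integral_prod_left

theorem flow_smul_op {V : Type*} [NormedAddCommGroup V] [NormedSpace ℝ V] (G : V →L[ℝ] V)
    (c t : ℝ) : flow (c • G) t = flow G (t * c) := by
  rw [flow, flow, smul_smul]

/-- The duality relation between the exclusion process and the exclusion dynamics on tuples. -/
theorem IsKSEP.dualMean_eq (hp : IsJumpKernel p) (hK : 1 ≤ K)
    (hX : IsKSEP p K P η X) (hη : ∀ x, η x = 0 ∨ η x = K) {t : ℝ} (ht : 0 ≤ t) :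
    dualMean K P X hX.le_K M t =
      exclSemi hp M K (t * K) (admInd M K * prodFun M (siteInd (occupied η))) := by
  have h := eq_flow_of_integral_eq ((K : ℝ) • exclGen hp M K) (dualMean K P X hX.le_K M)
    (C := 1) (norm_dualMean_le hX.le_K)
    -- Negative times are truncated to `0` by `Real.toNNReal`.
    (fun s => by
      ext x
      rw [dualMean_apply, dualMean_apply]
      rw [← Real.coe_toNNReal', Real.toNNReal_coe])
    (fun x t => hX.intervalIntegrable hp hK x t)
    (fun x t ht => hX.dualMean_integral_eq hp hK x ht) ht
  rw [h, flow_smul_op, exclSemi_eq_flow]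
  congr 1
  -- Identification of the initial datum, where `η ∈ {0, K}` enters: on an admissible tuple the
  -- duality function is `1` if all its sites are full and `0` if one of them is empty.
  ext x
  have h0 : ∀ᵐ ω ∂P, dual K x (X (0 : ℝ).toNNReal ω) = dual K x η := by
    filter_upwards [hX.initial] with ω hω
    rw [Real.toNNReal_zero, hω]
  rw [dualMean_apply, integral_congr_ae h0]
  simp only [integral_const, probReal_univ, one_smul]
  rw [BoundedContinuousFunction.coe_mul, Pi.mul_apply, admInd_apply, prodFun_apply]
  split_ifs with hx
  · simp [dual, hx]
  have hx' : (exclWeight K x : ℝ) ≠ 0 := by exact_mod_cast hx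
  have hind : ∀ y, siteInd (occupied η) y = if η y = 0 then 0 else 1 := by
    intro y
    rw [siteInd_apply, occupied]
    by_cases hy : η y = 0 <;> simp [hy, Nat.pos_iff_ne_zero]
  rw [one_mul]
  by_cases hz : ∃ i, η (x i) = 0
  · obtain ⟨i, hi⟩ := hz
    rw [Finset.prod_eq_zero (Finset.mem_univ i) (by rw [hind, if_pos hi])]
    have : facProd η x = 0 := by
      by_contra hne
      have := (facProd_ne_zero_iff η x).1 hne (x i)
      have := occ_pos x i
      omega
    simp [dual, this]
  · push Not at hz
    rw [Finset.prod_eq_one fun i _ => by rw [hind, if_neg (hz i)]]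
    have : facProd η x = exclWeight K x := by
      rw [exclWeight, facProd_eq_prod η x subset_rfl, facProd_eq_prod _ x subset_rfl]
      refine Finset.prod_congr rfl fun u hu => ?_
      obtain ⟨i, -, rfl⟩ := Finset.mem_image.1 hu
      rw [(hη (x i)).resolve_left (hz i)]
    rw [dual, this, div_self hx']

/-- The mean number of particles at a site. -/
theorem IsKSEP.integral_apply (hp : IsJumpKernel p) (hK : 1 ≤ K)
    (hX : IsKSEP p K P η X) (hη : ∀ x, η x = 0 ∨ η x = K) (t : ℝ≥0) (y : ℤ) :
    ∫ ω, (X (t / K) ω y : ℝ) ∂P = K * walkFun hp (occupied η) t y := by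
  have hKr : (K : ℝ) ≠ 0 := by positivity
  have hfac : ∀ ζ : ℤ → ℕ, facProd ζ (fun _ : Fin 1 => y) = ζ y := by
    intro ζ
    rw [facProd_eq_facOff_mul ζ _ 0]
    have : ∀ u, occOff (fun _ : Fin 1 => y) 0 u = 0 := fun u => by simp [occOff]
    simp [this, facOff]
  have hw : exclWeight K (fun _ : Fin 1 => y) = K := hfac _
  have h1 := congrArg (fun f : (Fin 1 → ℤ) →ᵇ ℝ => f fun _ => y)
    (hX.dualMean_eq hp hK hη (M := 1) (t := (t / K : ℝ≥0)) (NNReal.coe_nonneg _))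
  have h2 := admInd_mul_prodFun_eq hp 1 K (occupied η) t.2 (fun _ => y)
  -- A single coordinate has no pairs, so there is no source: the mean evolves exactly as the walk.
  have h3 : ∀ h : ℤ →ᵇ ℝ, source hp 1 K h = 0 := by
    intro h; ext x; rw [source_apply hp hK]; simp
  have h4 : ((t / K : ℝ≥0) : ℝ) * K = t := by
    push_cast; field_simp
  have hK0 : K ≠ 0 := by omega
  simp only [h3, map_zero, BoundedContinuousFunction.coe_zero, Pi.zero_apply,
    intervalIntegral.integral_zero, add_zero, admInd_apply, hw, prodFun_apply,
    Fin.prod_univ_one, if_neg hK0, one_mul] at h2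
  simp only [dualMean_apply, h4, dual, hfac, hw, Real.toNNReal_coe] at h1
  rw [integral_div, div_eq_iff hKr] at h1
  rw [h1, mul_comm]
  congr 1
  exact h2.symm

end MartingaleProblem

/-! ### Factorial measures and moments as sums over tuples -/

section Particles

/-- The sites in the interval `(a, b]`. -/
noncomputable def sites (a b : ℝ) : Finset ℤ := Finset.Ioc ⌊a⌋ ⌊b⌋

theorem mem_sites {a b : ℝ} {y : ℤ} : y ∈ sites a b ↔ (y : ℝ) ∈ Ioc a b := by
  rw [sites, Finset.mem_Ioc, Int.floor_lt, Int.le_floor, mem_Ioc]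

/-- The particles in the interval `(a, b]`. -/
def particlesInEquiv (ζ : ℤ → ℕ) (a b : ℝ) :
    {q : Particle ζ // q.pos ∈ Ioc a b} ≃ Σ y : sites a b, Fin (ζ y) where
  toFun q := ⟨⟨q.1.1.1, mem_sites.2 q.2⟩, ⟨q.1.1.2, q.1.2⟩⟩
  invFun q := ⟨⟨(q.1.1, q.2.1), q.2.2⟩, mem_sites.1 q.1.2⟩
  left_inv _ := rfl
  right_inv _ := rfl

/-- The contributing index tuples are the embeddings of `Fin n` into the finite set of particles in
the interval, and a falling factorial counts these. -/
theorem particleFactorialMeasure_pi (ζ : ℤ → ℕ) (n : ℕ) (a b : ℝ) :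
    particleFactorialMeasure ζ n (Set.univ.pi fun _ => Ioc a b) =
      ((∑ y ∈ sites a b, ζ y).descFactorial n : ℕ) := by
  have hm : MeasurableSet (Set.univ.pi fun _ : Fin n => Ioc a b) :=
    MeasurableSet.univ_pi fun _ => measurableSet_Ioc
  rw [particleFactorialMeasure, factorialMeasure, Measure.sum_apply _ hm]
  have h1 : ∀ i : Fin n ↪ Particle ζ,
      Measure.dirac (fun r => (i r).pos) (Set.univ.pi fun _ : Fin n => Ioc a b) =
        {i : Fin n ↪ Particle ζ | ∀ r, (i r).pos ∈ Ioc a b}.indicator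
          (fun _ => (1 : ℝ≥0∞)) i := by
    intro i
    rw [Measure.dirac_apply' _ hm]
    by_cases h : ∀ r, (i r).pos ∈ Ioc a b
    · rw [indicator_of_mem (by simpa using h), indicator_of_mem (by exact h)]; rfl
    · rw [indicator_of_notMem (by simpa using h), indicator_of_notMem (by exact h)]
  simp_rw [h1]
  let e : {i : Fin n ↪ Particle ζ | ∀ r, (i r).pos ∈ Ioc a b} ≃
      (Fin n ↪ Σ y : sites a b, Fin (ζ y)) :=
    (Equiv.codRestrict (Fin n) {q : Particle ζ | q.pos ∈ Ioc a b}).trans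
      ((Equiv.refl _).embeddingCongr (particlesInEquiv ζ a b))
  rw [← tsum_subtype, ← e.symm.tsum_eq, tsum_fintype, Finset.sum_const, Finset.card_univ,
    Fintype.card_embedding_eq, Fintype.card_sigma, Fintype.card_fin]
  simp only [Fintype.card_fin, nsmul_eq_mul, mul_one]
  rw [Finset.sum_coe_sort (sites a b) ζ]

theorem particleMeasure_Ioc (ζ : ℤ → ℕ) (a b : ℝ) :
    particleMeasure ζ (Ioc a b) = (∑ y ∈ sites a b, ζ y : ℕ) := by
  rw [particleMeasure, countingMeasure, Measure.sum_apply _ measurableSet_Ioc]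
  have h1 : ∀ q : Particle ζ, Measure.dirac q.pos (Ioc a b) =
      {q : Particle ζ | q.pos ∈ Ioc a b}.indicator (fun _ => (1 : ℝ≥0∞)) q := by
    intro q
    rw [Measure.dirac_apply' _ measurableSet_Ioc]
    rfl
  simp_rw [h1]
  let e : {q : Particle ζ | q.pos ∈ Ioc a b} ≃ Σ y : sites a b, Fin (ζ y) :=
    particlesInEquiv ζ a b
  rw [← tsum_subtype, ← e.symm.tsum_eq, tsum_fintype, Finset.sum_const, Finset.card_univ,
    Fintype.card_sigma]
  simp only [Fintype.card_fin, nsmul_eq_mul, mul_one]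
  rw [Finset.sum_coe_sort (sites a b) ζ]

theorem occOff_cons {M : ℕ} (x : Fin M → ℤ) (y : ℤ) :
    occOff (Fin.cons y x : Fin (M + 1) → ℤ) 0 = occ x := by
  funext u
  rw [occOff, occ, Fin.univ_succ, Finset.filter_cons]
  simp [Finset.filter_map, Fin.succ_ne_zero]

theorem facProd_cons {M : ℕ} (ζ : ℤ → ℕ) (x : Fin M → ℤ) (y : ℤ) :
    facProd ζ (Fin.cons y x : Fin (M + 1) → ℤ) = facProd ζ x * (ζ y - occ x y) := by
  rw [facProd_eq_facOff_mul _ _ 0, facOff, occOff_cons, Fin.cons_zero, facProd]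

/-- Truncated subtraction may be replaced by the real one: if `occ x y` exceeds `ζ y`, the factor
`facProd ζ x` is already zero. -/
theorem cast_facProd_cons {M : ℕ} (ζ : ℤ → ℕ) (x : Fin M → ℤ) (y : ℤ) :
    (facProd ζ (Fin.cons y x : Fin (M + 1) → ℤ) : ℝ) =
      facProd ζ x * ((ζ y : ℝ) - occ x y) := by
  rw [facProd_cons]
  by_cases h : occ x y ≤ ζ y
  · push_cast [Nat.cast_sub h]; rfl
  · have : facProd ζ x = 0 := by
      by_contra h0
      exact h ((facProd_ne_zero_iff ζ x).1 h0 y)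
    simp [this]

theorem sum_piFinset_cons {M : ℕ} (S : Fin (M + 1) → Finset ℤ) (f : (Fin (M + 1) → ℤ) → ℝ) :
    ∑ x ∈ Fintype.piFinset S, f x =
      ∑ x ∈ Fintype.piFinset (fun j => S (Fin.succ j)), ∑ y ∈ S 0, f (Fin.cons y x) := by
  rw [← Finset.sum_product']
  refine Finset.sum_nbij' (fun x => (Fin.tail x, x 0)) (fun q => Fin.cons q.2 q.1) ?_ ?_ ?_ ?_ ?_
  · intro x hx
    rw [Fintype.mem_piFinset] at hx
    rw [Finset.mem_product, Fintype.mem_piFinset]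
    exact ⟨fun j => hx j.succ, hx 0⟩
  · intro q hq
    rw [Finset.mem_product, Fintype.mem_piFinset] at hq
    rw [Fintype.mem_piFinset]
    intro j
    refine Fin.cases ?_ (fun j => ?_) j
    · exact hq.2
    · exact hq.1 j
  · intro x _; exact Fin.cons_self_tail x
  · intro q _; rfl
  · intro x _; exact congrArg f (Fin.cons_self_tail x).symm

/-- A multivariate Vandermonde identity for falling factorials. -/
theorem sum_facProd {M m : ℕ} (ζ : ℤ → ℕ) (S : Fin m → Finset ℤ)
    (hS : Pairwise fun k l => Disjoint (S k) (S l)) (c : Fin M → Fin m) :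
    ∑ x ∈ Fintype.piFinset (fun j => S (c j)), (facProd ζ x : ℝ) =
      ∏ k, ((∑ y ∈ S k, ζ y).descFactorial (Finset.univ.filter fun j => c j = k).card : ℝ) := by
  induction M with
  | zero =>
    have : ∀ x : Fin 0 → ℤ, facProd ζ x = 1 := fun x => by
      rw [facProd_eq_prod ζ x subset_rfl]; simp
    simp [this]
  | succ M ih =>
    have hcard : ∀ k, (Finset.univ.filter fun j => c j = k).card =
        (Finset.univ.filter fun j : Fin M => c j.succ = k).card + if c 0 = k then 1 else 0 := by
      intro k
      rw [Fin.univ_succ, Finset.filter_cons]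
      split_ifs <;> simp [Finset.filter_map]
    rw [sum_piFinset_cons]
    have h1 : ∀ x ∈ Fintype.piFinset (fun j : Fin M => S (c j.succ)),
        ∑ y ∈ S (c 0), (facProd ζ (Fin.cons y x : Fin (M + 1) → ℤ) : ℝ) =
        facProd ζ x * (((∑ y ∈ S (c 0), ζ y : ℕ) : ℝ) -
          (Finset.univ.filter fun j : Fin M => c j.succ = c 0).card) := by
      intro x hx
      rw [Fintype.mem_piFinset] at hx
      simp_rw [cast_facProd_cons]
      rw [← Finset.mul_sum, Finset.sum_sub_distrib]
      congr 2
      · push_cast; rfl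
      · simp_rw [occ_eq_sum]
        rw [Finset.sum_comm, Finset.card_filter]
        push_cast
        refine Finset.sum_congr rfl fun j _ => ?_
        rw [Finset.sum_ite_eq]
        -- Disjointness of the sets `S k` ensures that only coordinates of the same block can
        -- collide with the new one.
        have : x j ∈ S (c 0) ↔ c j.succ = c 0 := by
          refine ⟨fun h => ?_, fun h => h ▸ hx j⟩
          by_contra hne
          exact Finset.disjoint_left.1 (hS hne) (hx j) h
        simp [this]
    rw [Finset.sum_congr rfl h1, ← Finset.sum_mul, ih fun j => c j.succ]
    simp_rw [hcard]
    rw [← Finset.mul_prod_erase _ _ (Finset.mem_univ (c 0)),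
      ← Finset.mul_prod_erase _ (fun k => ((∑ y ∈ S k, ζ y).descFactorial
        ((Finset.univ.filter fun j : Fin M => c j.succ = k).card +
          if c 0 = k then 1 else 0) : ℝ)) (Finset.mem_univ (c 0)), if_pos rfl,
      cast_descFactorial_succ]
    have h2 : ∏ k ∈ Finset.univ.erase (c 0), ((∑ y ∈ S k, ζ y).descFactorial
        ((Finset.univ.filter fun j : Fin M => c j.succ = k).card +
          if c 0 = k then 1 else 0) : ℝ) =
        ∏ k ∈ Finset.univ.erase (c 0), ((∑ y ∈ S k, ζ y).descFactorial
        (Finset.univ.filter fun j : Fin M => c j.succ = k).card : ℝ) := by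
      refine Finset.prod_congr rfl fun k hk => ?_
      rw [if_neg (Finset.ne_of_mem_erase hk).symm, add_zero]
    rw [h2]
    ring

/-- The block of an index in the concatenation of blocks of sizes `n k`. -/
def blockIndex {m : ℕ} (n : Fin m → ℕ) (j : Fin (∑ k, n k)) : Fin m := (finSigmaFinEquiv.symm j).1

theorem card_blockIndex {m : ℕ} (n : Fin m → ℕ) (k : Fin m) :
    (Finset.univ.filter fun j => blockIndex n j = k).card = n k := by
  rw [Finset.card_filter, ← finSigmaFinEquiv.sum_comp, Fintype.sum_sigma]
  simp [blockIndex]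

theorem prod_blockIndex {m : ℕ} (n : Fin m → ℕ) (f : Fin m → ℝ) :
    ∏ j, f (blockIndex n j) = ∏ k, f k ^ n k := by
  rw [← finSigmaFinEquiv.prod_comp, Fintype.prod_sigma]
  simp [blockIndex]

variable {p : ℤ → ℤ → ℝ} {K : ℕ} {Ω : Type*} [MeasurableSpace Ω] {P : Measure Ω}
  {η : ℤ → ℕ} {X : ℝ≥0 → Ω → ℤ → ℕ} [IsProbabilityMeasure P]

theorem IsKSEP.meanMeasure_eq (hp : IsJumpKernel p) (hK : 1 ≤ K)
    (hX : IsKSEP p K P η X) (hη : ∀ x, η x = 0 ∨ η x = K) (t : ℝ≥0) (a b : ℝ) :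
    meanMeasure P (X (t / K)) (Ioc a b) =
      ENNReal.ofReal (∑ y ∈ sites a b, K * walkFun hp (occupied η) t y) := by
  have hi : ∀ y, Integrable (fun ω => (X (t / K) ω y : ℝ)) P := fun y => by
    refine Integrable.of_bound (C := K) ?_ (Eventually.of_forall fun ω => ?_)
    · exact ((measurable_from_nat (f := fun k : ℕ => (k : ℝ))).comp
        ((measurable_pi_apply y).comp (hX.measurable _))).aestronglyMeasurable
    · rw [Real.norm_natCast]; exact_mod_cast hX.le_K _ ω y
  rw [meanMeasure]
  simp_rw [particleMeasure_Ioc, ← hX.integral_apply hp hK hη]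
  rw [← integral_finsetSum _ fun y _ => hi y, ofReal_integral_eq_lintegral_ofReal
    (integrable_finsetSum _ fun y _ => hi y)
    (Eventually.of_forall fun ω => Finset.sum_nonneg fun y _ => by positivity)]
  refine lintegral_congr fun ω => ?_
  rw [← Nat.cast_sum, ENNReal.ofReal_natCast]

/-- Inside the expectation the Vandermonde identity produces the sum of `facProd`, which is weight
times duality function. Duality runs at speed `K`, so process time `t / K` becomes dual time `t`. -/
theorem IsKSEP.jointFactorialMoment_eq (hp : IsJumpKernel p) (hK : 1 ≤ K)
    (hX : IsKSEP p K P η X) (hη : ∀ x, η x = 0 ∨ η x = K) (t : ℝ≥0) {m : ℕ} (a b : Fin m → ℝ)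
    (hdisj : Pairwise fun k l => Disjoint (Ioc (a k) (b k)) (Ioc (a l) (b l))) (n : Fin m → ℕ) :
    jointFactorialMoment P (X (t / K)) n (fun k => Ioc (a k) (b k)) =
      ENNReal.ofReal (∑ x ∈ Fintype.piFinset
          (fun j => sites (a (blockIndex n j)) (b (blockIndex n j))),
        (exclWeight K x : ℝ) * exclSemi hp (∑ k, n k) K t
          (admInd _ K * prodFun _ (siteInd (occupied η))) x) := by
  have hS : Pairwise fun k l => Disjoint (sites (a k) (b k)) (sites (a l) (b l)) := by
    intro k l hkl
    rw [Finset.disjoint_left]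
    intro y hy hy'
    exact Set.disjoint_left.1 (hdisj hkl) (mem_sites.1 hy) (mem_sites.1 hy')
  have h4 : ((t / K : ℝ≥0) : ℝ) * K = t := by
    have : (K : ℝ) ≠ 0 := by positivity
    push_cast; field_simp
  have hd := hX.dualMean_eq hp hK hη (M := ∑ k, n k) (t := (t / K : ℝ≥0)) (NNReal.coe_nonneg _)
  rw [h4] at hd
  rw [← hd]
  simp_rw [dualMean_apply, Real.toNNReal_coe, ← integral_const_mul,
    exclWeight_mul_dual (hX.le_K _ _)]
  have hi : ∀ x : Fin (∑ k, n k) → ℤ,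
      Integrable (fun ω => (facProd (X (t / K) ω) x : ℝ)) P := by
    intro x
    have := (hX.integrable_dual x (t / K)).const_mul (exclWeight K x : ℝ)
    simpa only [exclWeight_mul_dual (hX.le_K _ _)] using this
  rw [← integral_finsetSum _ fun x _ => hi x, ofReal_integral_eq_lintegral_ofReal
    (integrable_finsetSum _ fun x _ => hi x)
    (Eventually.of_forall fun ω => Finset.sum_nonneg fun y _ => by positivity),
    jointFactorialMoment]
  refine lintegral_congr fun ω => ?_
  rw [sum_facProd (X (t / K) ω) (fun k => sites (a k) (b k)) hS (blockIndex n)]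
  simp_rw [particleFactorialMeasure_pi, card_blockIndex]
  rw [← Nat.cast_prod, ← Nat.cast_prod, ENNReal.ofReal_natCast]

end Particles

/-! ### Pair estimates producing `τ` and `κ` -/

section Estimate

open scoped BoundedContinuousFunction

theorem tsum_prod_apply {M : ℕ} (ψ : Fin M → ℤ → ℝ≥0∞) :
    ∑' x : Fin M → ℤ, ∏ j, ψ j (x j) = ∏ j, ∑' y, ψ j y := by
  induction M with
  | zero => simp
  | succ M ih =>
    rw [← (Fin.consEquiv fun _ : Fin (M + 1) => ℤ).tsum_eq, ENNReal.tsum_prod', Fin.prod_univ_succ,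
      ← ih fun j => ψ j.succ, ← ENNReal.tsum_mul_right]
    refine tsum_congr fun y => ?_
    rw [← ENNReal.tsum_mul_left]
    refine tsum_congr fun x => ?_
    rw [Fin.prod_univ_succ]
    simp [Fin.consEquiv]

theorem tsum_pair_mul_prod {M : ℕ} {i j : Fin M} (hij : i ≠ j) (φ : ℤ → ℤ → ℝ≥0∞)
    (ψ : ℤ → ℝ≥0∞) :
    ∑' x : Fin M → ℤ, φ (x i) (x j) * ∏ l ∈ (Finset.univ.erase i).erase j, ψ (x l) =
      (∑' a, ∑' b, φ a b) * (∑' y, ψ y) ^ (M - 2) := by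
  classical
  have hj : j ∈ Finset.univ.erase i := Finset.mem_erase.2 ⟨hij.symm, Finset.mem_univ j⟩
  have split : ∀ f : Fin M → ℝ≥0∞, ∏ l, f l =
      f i * (f j * ∏ l ∈ (Finset.univ.erase i).erase j, f l) := fun f => by
    rw [← Finset.mul_prod_erase _ _ (Finset.mem_univ i), ← Finset.mul_prod_erase _ _ hj]
  -- Fixing the values `a`, `b` of the two special coordinates by point indicators turns the summand
  -- into a product over coordinates, to which `tsum_prod_apply` applies.
  let χ : ℤ → ℤ → Fin M → ℤ → ℝ≥0∞ := fun a b l y =>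
    if l = i then (if y = a then 1 else 0) else if l = j then (if y = b then 1 else 0) else ψ y
  have hrest : ∀ a b, ∀ l ∈ (Finset.univ.erase i).erase j, χ a b l = ψ := by
    intro a b l hl
    funext y
    simp [χ, Finset.ne_of_mem_erase hl, Finset.ne_of_mem_erase (Finset.mem_of_mem_erase hl)]
  have hi' : ∀ a b y, χ a b i y = if y = a then 1 else 0 := fun a b y => by simp [χ]
  have hj' : ∀ a b y, χ a b j y = if y = b then 1 else 0 := fun a b y => by simp [χ, hij.symm]
  have h1 : ∀ x : Fin M → ℤ,
      φ (x i) (x j) * ∏ l ∈ (Finset.univ.erase i).erase j, ψ (x l) =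
      ∑' a, ∑' b, φ a b * ∏ l, χ a b l (x l) := by
    intro x
    have h2 : ∀ a b, φ a b * ∏ l, χ a b l (x l) =
        if b = x j then (if a = x i then φ a b *
          ∏ l ∈ (Finset.univ.erase i).erase j, ψ (x l) else 0) else 0 := by
      intro a b
      rw [split, hi', hj', Finset.prod_congr rfl fun l hl => by rw [hrest a b l hl]]
      simp only [eq_comm (a := x i) (b := a), eq_comm (a := x j) (b := b)]
      by_cases ha : a = x i <;> by_cases hb : b = x j <;> simp [ha, hb]
    simp_rw [h2, tsum_ite_eq]
  simp_rw [h1]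
  rw [ENNReal.tsum_comm]
  rw [← ENNReal.tsum_mul_right]
  refine tsum_congr fun a => ?_
  rw [ENNReal.tsum_comm, ← ENNReal.tsum_mul_right]
  refine tsum_congr fun b => ?_
  rw [ENNReal.tsum_mul_left, tsum_prod_apply, split]
  simp_rw [hi', hj', tsum_ite_eq]
  rw [Finset.prod_congr rfl fun l hl => by rw [hrest a b l hl], Finset.prod_const,
    Finset.card_erase_of_mem hj, Finset.card_erase_of_mem (Finset.mem_univ i), Finset.card_univ,
    Fintype.card_fin, one_mul, one_mul, Nat.sub_sub]

theorem sum_Ioi_const (M : ℕ) (c : ℝ≥0∞) :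
    ∑ i : Fin M, ∑ _j ∈ Finset.Ioi i, c = (M.choose 2 : ℕ) * c := by
  induction M with
  | zero => simp
  | succ M ih =>
    rw [Fin.sum_univ_succ, Fin.sum_Ioi_zero (fun _ => c)]
    simp_rw [Fin.sum_Ioi_succ (fun _ => c), ih]
    rw [Nat.choose_succ_succ' M 1, Nat.choose_one_right]
    simp
    ring

theorem exclWeight_le_pow (M K : ℕ) (x : Fin M → ℤ) : (exclWeight K x : ℝ) ≤ K ^ M := by
  induction M with
  | zero =>
    rw [exclWeight, facProd_eq_prod _ x subset_rfl]; simp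
  | succ M ih =>
    rw [← Fin.cons_self_tail x, exclWeight, facProd_cons, pow_succ]
    push_cast
    exact mul_le_mul (ih _) (by exact_mod_cast Nat.sub_le _ _) (by positivity) (by positivity)

/-- If every coordinate receives one of `K` labels, `exclWeight` counts the labellings that separate
coordinates at the same site. The bound is a union bound over pairs, with the crude constant `K ^
M`; the induction adds one coordinate at a time. -/
theorem pow_sub_exclWeight_le {M K : ℕ} (hK : 1 ≤ K) (x : Fin M → ℤ) :
    (K : ℝ) ^ M - exclWeight K x ≤
      K ^ M * ∑ i, ∑ j ∈ Finset.Ioi i, if x i = x j then (1 : ℝ) else 0 := by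
  have hK' : (1 : ℝ) ≤ K := by exact_mod_cast hK
  induction M with
  | zero =>
    rw [exclWeight, facProd_eq_prod _ x subset_rfl]; simp
  | succ M ih =>
    obtain ⟨y, x, rfl⟩ : ∃ y x', x = Fin.cons y x' :=
      ⟨x 0, Fin.tail x, (Fin.cons_self_tail x).symm⟩
    have h1 := ih x
    have h2 : (exclWeight K (Fin.cons y x : Fin (M + 1) → ℤ) : ℝ) =
        exclWeight K x * ((K : ℝ) - occ x y) := cast_facProd_cons _ x y
    rw [h2, Fin.sum_univ_succ, Fin.sum_Ioi_zero (fun j : Fin (M + 1) =>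
      if (Fin.cons y x : Fin (M + 1) → ℤ) 0 = (Fin.cons y x : Fin (M + 1) → ℤ) j then
        (1 : ℝ) else 0)]
    simp_rw [Fin.sum_Ioi_succ (fun j : Fin (M + 1) => if (Fin.cons y x : Fin (M + 1) → ℤ) _ =
      (Fin.cons y x : Fin (M + 1) → ℤ) j then (1 : ℝ) else 0), Fin.cons_zero, Fin.cons_succ]
    have h3 : ∑ j, (if y = x j then (1 : ℝ) else 0) = occ x y := by
      rw [occ_eq_sum]
      exact Finset.sum_congr rfl fun j _ => by simp only [eq_comm]
    rw [h3]
    generalize ∑ i : Fin M, ∑ j ∈ Finset.Ioi i, (if x i = x j then (1 : ℝ) else 0) = s at *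
    have h4 := exclWeight_le_pow M K x
    have h5 : (0 : ℝ) ≤ occ x y := by positivity
    have h6 : (0 : ℝ) ≤ K ^ M := by positivity
    have h7 := mul_le_mul_of_nonneg_right h4 h5
    have h8 : (K : ℝ) ^ M * occ x y ≤ K * (K ^ M * occ x y) :=
      le_mul_of_one_le_left (by positivity) hK'
    have h9 := mul_le_mul_of_nonneg_left h1 (zero_le_one.trans hK')
    rw [pow_succ]
    nlinarith

variable {p : ℤ → ℤ → ℝ} {K : ℕ}

theorem tsum_siteInd_mul (a b : ℝ) (f : ℤ → ℝ) :
    ∑' y, ENNReal.ofReal (siteInd (Ioc a b) y) * ENNReal.ofReal (f y) =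
      ∑ y ∈ sites a b, ENNReal.ofReal (f y) := by
  rw [tsum_eq_sum (s := sites a b)]
  · refine Finset.sum_congr rfl fun y hy => ?_
    rw [siteInd_apply, if_pos (mem_sites.1 hy), ENNReal.ofReal_one, one_mul]
  · intro y hy
    rw [siteInd_apply, if_neg fun h => hy (mem_sites.2 h), ENNReal.ofReal_zero, zero_mul]

theorem prodFun_siteInd_of_mem {M : ℕ} {a b : ℝ} {x : Fin M → ℤ}
    (hx : x ∈ Fintype.piFinset fun _ : Fin M => sites a b) :
    prodFun M (siteInd (Ioc a b)) x = 1 := by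
  rw [prodFun_apply]
  refine Finset.prod_eq_one fun j _ => ?_
  rw [siteInd_apply, if_pos (mem_sites.1 (Fintype.mem_piFinset.1 hx j))]

/-- The contribution of the tuples with coinciding sites. -/
theorem sum_coincidence_le (hK : 1 ≤ K) (M : ℕ) (a b : ℝ) (h : ℤ → ℝ)
    (hh : ∀ y, 0 ≤ h y) :
    ∑ x ∈ Fintype.piFinset (fun _ : Fin M => sites a b),
      ENNReal.ofReal (((K : ℝ) ^ M - exclWeight K x) * ∏ j, h (x j)) ≤
    (K : ℝ≥0∞) ^ M * ((M.choose 2 : ℕ) *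
      ((∑ y ∈ sites a b, ENNReal.ofReal (h y ^ 2)) *
        (∑ y ∈ sites a b, ENNReal.ofReal (h y)) ^ (M - 2))) := by
  set φ : ℤ → ℤ → ℝ≥0∞ := fun u v => if v = u then
    ENNReal.ofReal (siteInd (Ioc a b) u) * ENNReal.ofReal (h u ^ 2) else 0 with hφ
  set ψ : ℤ → ℝ≥0∞ := fun y => ENNReal.ofReal (siteInd (Ioc a b) y) * ENNReal.ofReal (h y) with hψ
  have hψs : ∑' y, ψ y = ∑ y ∈ sites a b, ENNReal.ofReal (h y) := tsum_siteInd_mul a b h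
  have hφs : ∑' u, ∑' v, φ u v = ∑ y ∈ sites a b, ENNReal.ofReal (h y ^ 2) := by
    rw [← tsum_siteInd_mul a b fun y => h y ^ 2]
    exact tsum_congr fun u => tsum_ite_eq u _
  have hpt : ∀ x ∈ Fintype.piFinset (fun _ : Fin M => sites a b),
      ENNReal.ofReal (((K : ℝ) ^ M - exclWeight K x) * ∏ j, h (x j)) ≤
      (K : ℝ≥0∞) ^ M * ∑ i, ∑ j ∈ Finset.Ioi i,
        φ (x i) (x j) * ∏ l ∈ (Finset.univ.erase i).erase j, ψ (x l) := by
    intro x hx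
    have hx1 : ∀ l, siteInd (Ioc a b) (x l) = 1 := fun l => by
      rw [siteInd_apply, if_pos (mem_sites.1 (Fintype.mem_piFinset.1 hx l))]
    have hprod : 0 ≤ ∏ j, h (x j) := Finset.prod_nonneg fun j _ => hh _
    have h1 := mul_le_mul_of_nonneg_right (pow_sub_exclWeight_le hK x) hprod
    refine (ENNReal.ofReal_le_ofReal h1).trans (le_of_eq ?_)
    rw [mul_assoc, ENNReal.ofReal_mul (by positivity), ENNReal.ofReal_pow (by positivity),
      ENNReal.ofReal_natCast]
    congr 1
    rw [Finset.sum_mul, ENNReal.ofReal_sum_of_nonneg fun i _ => mul_nonneg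
      (Finset.sum_nonneg fun j _ => by split_ifs <;> norm_num) hprod]
    refine Finset.sum_congr rfl fun i _ => ?_
    rw [Finset.sum_mul, ENNReal.ofReal_sum_of_nonneg fun j _ => mul_nonneg
      (by split_ifs <;> norm_num) hprod]
    refine Finset.sum_congr rfl fun j hj => ?_
    have hij : i ≠ j := (Finset.mem_Ioi.1 hj).ne
    simp only [hφ, hψ, hx1, ENNReal.ofReal_one, one_mul]
    by_cases he : x i = x j
    · rw [if_pos he, if_pos he.symm, one_mul,
        ← Finset.mul_prod_erase _ _ (Finset.mem_univ i),
        ← Finset.mul_prod_erase _ (fun l => h (x l))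
          (Finset.mem_erase.2 ⟨hij.symm, Finset.mem_univ j⟩), ← he, ← mul_assoc, ← sq,
        ENNReal.ofReal_mul (sq_nonneg _), ENNReal.ofReal_prod_of_nonneg fun l _ => hh _]
    · rw [if_neg he, if_neg (Ne.symm he)]; simp
  calc _ ≤ ∑ x ∈ Fintype.piFinset (fun _ : Fin M => sites a b), (K : ℝ≥0∞) ^ M *
        ∑ i, ∑ j ∈ Finset.Ioi i,
          φ (x i) (x j) * ∏ l ∈ (Finset.univ.erase i).erase j, ψ (x l) := Finset.sum_le_sum hpt
    _ ≤ ∑' x : Fin M → ℤ, (K : ℝ≥0∞) ^ M * ∑ i, ∑ j ∈ Finset.Ioi i,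
          φ (x i) (x j) * ∏ l ∈ (Finset.univ.erase i).erase j, ψ (x l) :=
        ENNReal.sum_le_tsum _
    _ = _ := by
      rw [ENNReal.tsum_mul_left, Summable.tsum_finsetSum fun _ _ => ENNReal.summable,
        ← sum_Ioi_const]
      congr 1
      refine Finset.sum_congr rfl fun i _ => ?_
      rw [Summable.tsum_finsetSum fun _ _ => ENNReal.summable]
      refine Finset.sum_congr rfl fun j hj => ?_
      rw [tsum_pair_mul_prod (Finset.mem_Ioi.1 hj).ne, hφs, hψs]

theorem kappa_eq (hp : IsJumpKernel p) (t : ℝ) (A B : Set ℝ) :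
    kappa p t A B = ∫⁻ s in Icc 0 t, ∑' u, ∑' v, ENNReal.ofReal (p u v) * ENNReal.ofReal
      ((walkFun hp B s u - walkFun hp B s v) ^ 2 *
        walkFun hp A (t - s) u * walkFun hp A (t - s) v) := by
  have hcont : ∀ (B : Set ℝ) (u : ℤ), Continuous fun s => walkFun hp B s u := fun B u =>
    (BoundedContinuousFunction.evalCLM ℝ u).continuous.comp (continuous_walkFun hp B)
  have hsub : Continuous fun s : ℝ => t - s := continuous_const.sub continuous_id
  have hmeas : ∀ u v, Measurable fun s => ENNReal.ofReal
      ((walkFun hp B s u - walkFun hp B s v) ^ 2 *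
        walkFun hp A (t - s) u * walkFun hp A (t - s) v) := fun u v =>
    (ENNReal.continuous_ofReal.comp (((((hcont B u).sub (hcont B v)).pow 2).mul
      ((hcont A u).comp hsub)).mul ((hcont A v).comp hsub))).measurable
  rw [kappa, lintegral_tsum fun u => (Measurable.tsum fun v =>
    (hmeas u v).const_mul _).aemeasurable]
  refine tsum_congr fun u => ?_
  rw [lintegral_tsum fun v => ((hmeas u v).const_mul _).aemeasurable]
  refine tsum_congr fun v => ?_
  rw [lintegral_const_mul _ (hmeas u v)]
  simp_rw [walkProb_eq hp]

/-- Duhamel's formula moved to `ℝ≥0∞`, where sums and time integrals can be exchanged freely. -/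
theorem ofReal_sub_exclSemi (hp : IsJumpKernel p) (hK : 1 ≤ K) (M : ℕ) (B : Set ℝ) {t : ℝ}
    (ht : 0 ≤ t) (x : Fin M → ℤ) :
    ENNReal.ofReal (admInd M K x * prodFun M (walkFun hp B t) x -
      exclSemi hp M K t (admInd M K * prodFun M (siteInd B)) x) =
    ∫⁻ s in Icc 0 t, ENNReal.ofReal
      (exclSemi hp M K (t - s) (source hp M K (walkFun hp B s)) x) := by
  have hc : Continuous fun s : ℝ =>
      exclSemi hp M K (t - s) (source hp M K (walkFun hp B s)) x := by
    rw [exclSemi_eq_flow]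
    exact (BoundedContinuousFunction.evalCLM ℝ x).continuous.comp
      (((continuous_flow _).comp (continuous_const.sub continuous_id)).clm_apply
        (continuous_source hp M K B))
  rw [admInd_mul_prodFun_eq hp M K B ht, add_sub_cancel_left, intervalIntegral.integral_of_le ht,
    ← integral_Icc_eq_integral_Ioc, ofReal_integral_eq_lintegral_ofReal
      hc.continuousOn.integrableOn_Icc]
  refine (ae_restrict_iff' measurableSet_Icc).2 (Eventually.of_forall fun s hs => ?_)
  exact (isPosOp_exclOp hp).semi_op _ (sub_nonneg.2 hs.2) _
    (source_nonneg hp hK (walkFun_nonneg hp B hs.1)) x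

/-- The effect of the interaction, summed over the starting points. -/
theorem sum_interaction_le (hp : IsJumpKernel p) (hK : 1 ≤ K) (M : ℕ) (B : Set ℝ) {t : ℝ}
    (ht : 0 ≤ t) (a b : ℝ) :
    ∑ x ∈ Fintype.piFinset (fun _ : Fin M => sites a b), (exclWeight K x : ℝ≥0∞) *
      ENNReal.ofReal (admInd M K x * prodFun M (walkFun hp B t) x -
        exclSemi hp M K t (admInd M K * prodFun M (siteInd B)) x) ≤
    (K : ℝ≥0∞) ^ M * ((M.choose 2 : ℕ) * (kappa p t (Ioc a b) B *
      (∑ y ∈ sites a b, ENNReal.ofReal (walkFun hp B t y)) ^ (M - 2))) := by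
  set A := Ioc a b with hA
  set f : (Fin M → ℤ) →ᵇ ℝ := admInd M K * prodFun M (siteInd A) with hf
  set g : ℝ → (Fin M → ℤ) →ᵇ ℝ := fun s => source hp M K (walkFun hp B s) with hg
  have hadm : ∀ x, 0 ≤ admInd M K x := fun x => by rw [admInd_apply]; split_ifs <;> norm_num
  have hadm1 : ∀ x, admInd M K x ≤ 1 := fun x => by rw [admInd_apply]; split_ifs <;> norm_num
  have hf0 : ∀ x, 0 ≤ f x := fun x => mul_nonneg (hadm x) (by
    rw [prodFun_apply]; exact Finset.prod_nonneg fun j _ => siteInd_nonneg A _)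
  have hg0 : ∀ s, 0 ≤ s → ∀ x, 0 ≤ g s x := fun s hs =>
    source_nonneg hp hK (walkFun_nonneg hp B hs)
  have hcont : ∀ x, Continuous fun s : ℝ => exclSemi hp M K (t - s) (g s) x := by
    intro x
    rw [exclSemi_eq_flow]
    exact (BoundedContinuousFunction.evalCLM ℝ x).continuous.comp
      (((continuous_flow _).comp (continuous_const.sub continuous_id)).clm_apply
        (continuous_source hp M K B))
  have step1 : ∑ x ∈ Fintype.piFinset (fun _ : Fin M => sites a b), (exclWeight K x : ℝ≥0∞) *
      ENNReal.ofReal (admInd M K x * prodFun M (walkFun hp B t) x -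
        exclSemi hp M K t (admInd M K * prodFun M (siteInd B)) x) ≤
      ∑' x : Fin M → ℤ, ∫⁻ s in Icc 0 t, (exclWeight K x : ℝ≥0∞) * (ENNReal.ofReal (f x) *
        ENNReal.ofReal (exclSemi hp M K (t - s) (g s) x)) := by
    refine le_trans (Finset.sum_le_sum fun x hx => ?_) (ENNReal.sum_le_tsum _)
    rw [ofReal_sub_exclSemi hp hK M B ht, lintegral_const_mul' _ _ (by simp),
      lintegral_const_mul' _ _ ENNReal.ofReal_ne_top]
    rcases eq_or_ne (exclWeight K x) 0 with h0 | h0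
    · simp [h0]
    · have : f x = 1 := by
        rw [hf, BoundedContinuousFunction.coe_mul, Pi.mul_apply, prodFun_siteInd_of_mem hx,
          admInd_apply, if_neg h0, one_mul]
      rw [this, ENNReal.ofReal_one, one_mul]
  refine step1.trans ?_
  have hmeas : ∀ x, Measurable fun s => (exclWeight K x : ℝ≥0∞) * (ENNReal.ofReal (f x) *
      ENNReal.ofReal (exclSemi hp M K (t - s) (g s) x)) := fun x =>
    ((ENNReal.measurable_ofReal.comp (hcont x).measurable).const_mul _).const_mul _
  rw [← lintegral_tsum fun x => (hmeas x).aemeasurable]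
  set m := ∑ y ∈ sites a b, ENNReal.ofReal (walkFun hp B t y) with hm
  set φ : ℝ → ℤ → ℤ → ℝ≥0∞ := fun s u v => ENNReal.ofReal (p u v) * ENNReal.ofReal
    ((walkFun hp B s u - walkFun hp B s v) ^ 2 *
        walkFun hp A (t - s) u * walkFun hp A (t - s) v) with hφ
  have step2 : ∀ s ∈ Icc 0 t, ∑' x : Fin M → ℤ, (exclWeight K x : ℝ≥0∞) *
      (ENNReal.ofReal (f x) * ENNReal.ofReal (exclSemi hp M K (t - s) (g s) x)) ≤
      (K : ℝ≥0∞) ^ M * ((M.choose 2 : ℕ) * ((∑' u, ∑' v, φ s u v) * m ^ (M - 2))) := by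
    intro s hs
    have hts : 0 ≤ t - s := sub_nonneg.2 hs.2
    have hA0 := walkFun_nonneg hp A hts
    have hB0 := walkFun_nonneg hp B hs.1
    -- Reversibility moves the semigroup at time `t - s` from the source to the indicator `f` of
    -- admissible tuples in `A`.
    have hsym := (isWeightSymm_exclOp (M := M) (K := K) hp).semi_op (isPosOp_exclOp hp) M hts
      f (g s) hf0 (hg0 s hs.1)
    refine (le_of_eq hsym).trans ?_
    set ψ : ℤ → ℝ≥0∞ := fun y => ENNReal.ofReal (walkFun hp A (t - s) y) *
      ENNReal.ofReal (walkFun hp B s y) with hψ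
    -- Chapman-Kolmogorov makes the factor of each spectator coordinate independent of `s`.
    have hψs : ∑' y, ψ y = m := by
      rw [hψ, tsum_walkFun_mul hp A B hts hs.1, hA, tsum_siteInd_mul, sub_add_cancel]
    have hpt : ∀ x : Fin M → ℤ, (exclWeight K x : ℝ≥0∞) *
        (ENNReal.ofReal (exclSemi hp M K (t - s) f x) * ENNReal.ofReal (g s x)) ≤
        (K : ℝ≥0∞) ^ M * ∑ i, ∑ j ∈ Finset.Ioi i,
          φ s (x i) (x j) * ∏ l ∈ (Finset.univ.erase i).erase j, ψ (x l) := by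
      intro x
      have e1 : (exclWeight K x : ℝ≥0∞) ≤ (K : ℝ≥0∞) ^ M := by
        have := exclWeight_le_pow M K x
        exact_mod_cast this
      have hprodA : 0 ≤ ∏ j, walkFun hp A (t - s) (x j) := Finset.prod_nonneg fun j _ => hA0 _
      -- The comparison is used a second time, now with `A` as target set.
      have e2 : exclSemi hp M K (t - s) f x ≤ ∏ j, walkFun hp A (t - s) (x j) := by
        refine (exclSemi_le hp hK A hts x).trans ?_
        rw [prodFun_apply]
        exact mul_le_of_le_one_left hprodA (hadm1 x)
      have hterm : ∀ i j, 0 ≤ p (x i) (x j) * (walkFun hp B s (x i) - walkFun hp B s (x j)) ^ 2 *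
          ∏ l ∈ (Finset.univ.erase i).erase j, walkFun hp B s (x l) := fun i j =>
        mul_nonneg (mul_nonneg (hp.nonneg _ _) (sq_nonneg _)) (Finset.prod_nonneg fun l _ => hB0 _)
      have e3 : g s x ≤ ∑ i, ∑ j ∈ Finset.Ioi i,
          p (x i) (x j) * (walkFun hp B s (x i) - walkFun hp B s (x j)) ^ 2 *
          ∏ l ∈ (Finset.univ.erase i).erase j, walkFun hp B s (x l) := by
        have hn := Finset.sum_nonneg fun i (_ : i ∈ Finset.univ) =>
          Finset.sum_nonneg fun j (_ : j ∈ Finset.Ioi i) => hterm i j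
        -- The factor `K⁻¹` of the source is simply given away.
        have hKinv : (K : ℝ)⁻¹ ≤ 1 := inv_le_one_of_one_le₀ (by exact_mod_cast hK)
        simp only [hg]
        rw [source_apply hp hK]
        exact (mul_le_of_le_one_left (mul_nonneg (by positivity) hn) (hadm1 x)).trans
          (mul_le_of_le_one_left hn hKinv)
      refine mul_le_mul' e1 ?_
      refine (mul_le_mul' (ENNReal.ofReal_le_ofReal e2) (ENNReal.ofReal_le_ofReal e3)).trans
        (le_of_eq ?_)
      rw [ENNReal.ofReal_sum_of_nonneg fun i _ => Finset.sum_nonneg fun j _ => hterm i j,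
        Finset.mul_sum]
      refine Finset.sum_congr rfl fun i _ => ?_
      rw [ENNReal.ofReal_sum_of_nonneg fun j _ => hterm i j, Finset.mul_sum]
      refine Finset.sum_congr rfl fun j hj => ?_
      have hij : i ≠ j := (Finset.mem_Ioi.1 hj).ne
      simp only [hφ, hψ]
      rw [Finset.prod_mul_distrib, ← ENNReal.ofReal_prod_of_nonneg fun l _ => hA0 _,
        ← ENNReal.ofReal_prod_of_nonneg fun l _ => hB0 _, ← ENNReal.ofReal_mul hprodA,
        ← ENNReal.ofReal_mul (hp.nonneg _ _),
        ← ENNReal.ofReal_mul (Finset.prod_nonneg fun l _ => hA0 _), ← ENNReal.ofReal_mul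
          (mul_nonneg (hp.nonneg _ _) (mul_nonneg (mul_nonneg (sq_nonneg _) (hA0 _)) (hA0 _))),
        ← Finset.mul_prod_erase _ _ (Finset.mem_univ i),
        ← Finset.mul_prod_erase _ (fun l => walkFun hp A (t - s) (x l))
          (Finset.mem_erase.2 ⟨hij.symm, Finset.mem_univ j⟩)]
      congr 1
      ring
    refine (ENNReal.tsum_le_tsum hpt).trans (le_of_eq ?_)
    rw [ENNReal.tsum_mul_left, Summable.tsum_finsetSum fun _ _ => ENNReal.summable,
      ← sum_Ioi_const]
    congr 1
    refine Finset.sum_congr rfl fun i _ => ?_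
    rw [Summable.tsum_finsetSum fun _ _ => ENNReal.summable]
    refine Finset.sum_congr rfl fun j hj => ?_
    rw [tsum_pair_mul_prod (Finset.mem_Ioi.1 hj).ne, hψs]
  refine (setLIntegral_mono' measurableSet_Icc step2).trans (le_of_eq ?_)
  have hmtop : m ^ (M - 2) ≠ ∞ := ENNReal.pow_ne_top (ENNReal.sum_ne_top.2 fun y _ =>
    ENNReal.ofReal_ne_top)
  rw [lintegral_const_mul' _ _ (ENNReal.pow_ne_top (ENNReal.natCast_ne_top K)),
    lintegral_const_mul' _ _ (ENNReal.natCast_ne_top _), lintegral_mul_const' _ _ hmtop,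
    kappa_eq hp]

theorem tau_eq (hp : IsJumpKernel p) (t a b : ℝ) (B : Set ℝ) :
    tau p t (Ioc a b) B = ∑ y ∈ sites a b, ENNReal.ofReal (walkFun hp B t y ^ 2) := by
  rw [tau, tsum_eq_sum (s := sites a b)]
  · refine Finset.sum_congr rfl fun y hy => ?_
    rw [if_pos (mem_sites.1 hy), walkProb_eq hp]
  · intro y hy
    rw [if_neg fun h => hy (mem_sites.2 h)]

end Estimate

/-! ### Assembly of the two bounds -/

theorem proposition4p2 {p : ℤ → ℤ → ℝ} (hp : IsJumpKernel p) {K : ℕ} (hK : 1 ≤ K)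
    {Ω : Type*} [MeasurableSpace Ω] (P : Measure Ω) [IsProbabilityMeasure P]
    (η : ℤ → ℕ) (hη : ∀ x, η x = 0 ∨ η x = K)
    (X : ℝ≥0 → Ω → ℤ → ℕ) (hX : IsKSEP p K P η X)
    {m : ℕ} (hm : 1 ≤ m) (a b : Fin m → ℝ)
    (hdisj : Pairwise fun k l => Disjoint (Ioc (a k) (b k)) (Ioc (a l) (b l)))
    (n : Fin m → ℕ) (t : ℝ≥0) :
    (∀ k, meanMeasure P (X (t / K)) (Ioc (a k) (b k)) ≠ ∞) ∧
    jointFactorialMoment P (X (t / K)) n (fun k => Ioc (a k) (b k)) ≠ ∞ ∧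
    0 ≤ (∏ k, (meanMeasure P (X (t / K)) (Ioc (a k) (b k))).toReal ^ n k) -
        (jointFactorialMoment P (X (t / K)) n (fun k => Ioc (a k) (b k))).toReal ∧
    ENNReal.ofReal ((∏ k, (meanMeasure P (X (t / K)) (Ioc (a k) (b k))).toReal ^ n k) -
        (jointFactorialMoment P (X (t / K)) n (fun k => Ioc (a k) (b k))).toReal) ≤
      (K : ℝ≥0∞) ^ 2 * (((∑ k, n k).choose 2 : ℕ) : ℝ≥0∞) *
        meanMeasure P (X (t / K)) (Ioc (⨅ k, a k) (⨆ k, b k)) ^ ((∑ k, n k) - 2) *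
        (kappa p t (Ioc (⨅ k, a k) (⨆ k, b k)) (occupied η) +
          tau p t (Ioc (⨅ k, a k) (⨆ k, b k)) (occupied η)) := by
  set M := ∑ k, n k with hM
  set B := occupied η with hB
  set h := walkFun hp B t with hh
  have ht : (0 : ℝ) ≤ t := t.2
  have h0 : ∀ y, 0 ≤ h y := walkFun_nonneg hp B ht
  set u : (Fin M → ℤ) → ℝ := fun x =>
    exclSemi hp M K t (admInd M K * prodFun M (siteInd B)) x with hu
  have hu0 : ∀ x, 0 ≤ u x := by
    refine (isPosOp_exclOp hp).semi_op _ ht _ fun x => mul_nonneg ?_ ?_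
    · change 0 ≤ admInd M K x
      rw [admInd_apply]; split_ifs <;> norm_num
    · change 0 ≤ prodFun M (siteInd B) x
      rw [prodFun_apply]; exact Finset.prod_nonneg fun j _ => siteInd_nonneg B _
  have hule : ∀ x, u x ≤ admInd M K x * prodFun M h x := exclSemi_le hp hK B ht
  set PF := Fintype.piFinset (fun j => sites (a (blockIndex n j)) (b (blockIndex n j))) with hPF
  have hmean := hX.meanMeasure_eq hp hK hη t
  have hjoint := hX.jointFactorialMoment_eq hp hK hη t a b hdisj n
  have hmean_real : ∀ k, (meanMeasure P (X (t / K)) (Ioc (a k) (b k))).toReal =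
      ∑ y ∈ sites (a k) (b k), K * h y := fun k => by
    rw [hmean, ENNReal.toReal_ofReal (Finset.sum_nonneg fun y _ =>
      mul_nonneg (by positivity) (h0 y))]
  have hjoint_real : (jointFactorialMoment P (X (t / K)) n (fun k => Ioc (a k) (b k))).toReal =
      ∑ x ∈ PF, (exclWeight K x : ℝ) * u x := by
    rw [hjoint, ENNReal.toReal_ofReal (Finset.sum_nonneg fun x _ =>
      mul_nonneg (by positivity) (hu0 x))]
  have hadm : ∀ x : Fin M → ℤ, (exclWeight K x : ℝ) * admInd M K x = exclWeight K x := fun x => by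
    rw [admInd_apply]; split_ifs with h0 <;> simp [h0]
  -- The product of sums is expanded over tuples, and `w * ∏ h = w * (admInd * ∏ h)` is subtracted
  -- and added. The first part measures coincidences at the start, the second the interaction up to
  -- time `t`; both are nonnegative.
  have hdiff : (∏ k, (meanMeasure P (X (t / K)) (Ioc (a k) (b k))).toReal ^ n k) -
      (jointFactorialMoment P (X (t / K)) n (fun k => Ioc (a k) (b k))).toReal =
      ∑ x ∈ PF, (((K : ℝ) ^ M - exclWeight K x) * ∏ j, h (x j) +
        (exclWeight K x : ℝ) * (admInd M K x * prodFun M h x - u x)) := by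
    simp_rw [hmean_real]
    rw [hjoint_real, ← prod_blockIndex n fun k => ∑ y ∈ sites (a k) (b k), (K : ℝ) * h y,
      Finset.prod_univ_sum, ← Finset.sum_sub_distrib]
    refine Finset.sum_congr rfl fun x _ => ?_
    rw [Finset.prod_mul_distrib, Finset.prod_const, Finset.card_univ, Fintype.card_fin,
      mul_sub, ← mul_assoc (exclWeight K x : ℝ), hadm, prodFun_apply]
    ring
  have hterm1 : ∀ x : Fin M → ℤ, 0 ≤ ((K : ℝ) ^ M - exclWeight K x) * ∏ j, h (x j) := fun x =>
    mul_nonneg (sub_nonneg.2 (exclWeight_le_pow M K x)) (Finset.prod_nonneg fun j _ => h0 _)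
  have hterm2 : ∀ x : Fin M → ℤ,
      0 ≤ (exclWeight K x : ℝ) * (admInd M K x * prodFun M h x - u x) := fun x =>
    mul_nonneg (by positivity) (sub_nonneg.2 (hule x))
  refine ⟨fun k => by rw [hmean]; exact ENNReal.ofReal_ne_top,
    by rw [hjoint]; exact ENNReal.ofReal_ne_top, ?_, ?_⟩
  · rw [hdiff]
    exact Finset.sum_nonneg fun x _ => add_nonneg (hterm1 x) (hterm2 x)
  set α := ⨅ k, a k with hα
  set β := ⨆ k, b k with hβ
  -- Each interval is enlarged to the hull `(α, β]`; nonnegativity of the summands allows this.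
  have hsub : PF ⊆ Fintype.piFinset (fun _ : Fin M => sites α β) := by
    refine Fintype.piFinset_subset _ _ fun j y hy => ?_
    rw [mem_sites] at hy ⊢
    exact ⟨(ciInf_le (Set.finite_range a).bddBelow _).trans_lt hy.1,
      hy.2.trans (le_ciSup (Set.finite_range b).bddAbove _)⟩
  have hmeanA : meanMeasure P (X (t / K)) (Ioc α β) =
      K * ∑ y ∈ sites α β, ENNReal.ofReal (h y) := by
    rw [hmean, ← Finset.mul_sum, ENNReal.ofReal_mul (by positivity), ENNReal.ofReal_natCast,
      ENNReal.ofReal_sum_of_nonneg fun y _ => h0 y]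
  rw [hdiff, ENNReal.ofReal_sum_of_nonneg fun x _ => add_nonneg (hterm1 x) (hterm2 x), hmeanA,
    tau_eq hp]
  set c := ∑ y ∈ sites α β, ENNReal.ofReal (h y) with hc
  calc _ ≤ ∑ x ∈ Fintype.piFinset (fun _ : Fin M => sites α β), ENNReal.ofReal
        (((K : ℝ) ^ M - exclWeight K x) * ∏ j, h (x j) +
        (exclWeight K x : ℝ) * (admInd M K x * prodFun M h x - u x)) :=
        Finset.sum_le_sum_of_subset hsub
    _ = ∑ x ∈ Fintype.piFinset (fun _ : Fin M => sites α β), ENNReal.ofReal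
          (((K : ℝ) ^ M - exclWeight K x) * ∏ j, h (x j)) +
        ∑ x ∈ Fintype.piFinset (fun _ : Fin M => sites α β), (exclWeight K x : ℝ≥0∞) *
          ENNReal.ofReal (admInd M K x * prodFun M h x - u x) := by
        rw [← Finset.sum_add_distrib]
        refine Finset.sum_congr rfl fun x _ => ?_
        rw [ENNReal.ofReal_add (hterm1 x) (hterm2 x),
          ENNReal.ofReal_mul (p := (exclWeight K x : ℝ)) (by positivity), ENNReal.ofReal_natCast]
    _ ≤ (K : ℝ≥0∞) ^ M * ((M.choose 2 : ℕ) *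
          ((∑ y ∈ sites α β, ENNReal.ofReal (h y ^ 2)) * c ^ (M - 2))) +
        (K : ℝ≥0∞) ^ M * ((M.choose 2 : ℕ) * (kappa p t (Ioc α β) B * c ^ (M - 2))) :=
        add_le_add (sum_coincidence_le hK M α β h h0) (sum_interaction_le hp hK M B ht α β)
    _ = _ := by
        -- For `M ≤ 1` the binomial coefficient is zero, which kills both sides even if `κ` is
        -- infinite. Otherwise `K ^ M` splits into `K ^ 2` and the factors `K` that turn the sums
        -- `c` into means.
        rcases Nat.lt_or_ge M 2 with h2 | h2
        · simp [Nat.choose_eq_zero_of_lt h2]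
        · rw [mul_pow]
          have : (K : ℝ≥0∞) ^ M = (K : ℝ≥0∞) ^ 2 * (K : ℝ≥0∞) ^ (M - 2) := by
            rw [← pow_add]; congr 1; omega
          rw [this]
          ring
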